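/- **Setting.** Let $\Omega\subset\mathbb R^d$ be a bounded open set, $T>0$, $(\cdot,\cdot)$ the inner product of $L^2(\Omega)$, and $\mathcal V$ a real Hilbert space with continuous dense embedding $\mathcal V\subset L^2(\Omega)$, so that $\mathcal V\subset L^2(\Omega)\subset\mathcal V^*$; $\langle\cdot,\cdot\rangle$ is the duality pairing of $\mathcal V^*$ and $\mathcal V$. Let $\mathcal B$ be a bounded symmetric bilinear form on $\mathcal V$, and $\mathcal N(u;v)=\mathcal N_c(u;v)-\mathcal N_e(u;v)$, where $\mathcal N_c$ is a semilinear form on $\mathcal V\times\mathcal V$ and $\mathcal N_e$ one on $L^2(\Omega)\times L^2(\Omega)$, both bounded and linear in the second argument. Both are continuously Gâteaux differentiable: $F'(x)(w,v)=\lim_{s\to0}\frac{F(x+sw;v)-F(x;v)}{s}$ exists, is a bounded bilinear form in $(w,v)$, and is continuous in $x$ for fixed $w,v$. For $F\in\{\mathcal N,\mathcal N_c,\mathcal N_e\}$ put $F^s(u,\hat u;w,v)=\int_0^1F'(su+(1-s)\hat u)(w,v)\,ds$. Let $f\in L^2(0,T;\mathcal V^*)$, $u^0,\bar q\in L^2(\Omega)$,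 $q\in L^2(0,T;L^2(\Omega))$, and $$\mathcal Q(w)=(\bar q,w(T))+\int_0^T(q,w)\,dt .$$ Let $\mathcal W=\{v\in L^2(0,T;\mathcal V):\partial_tv\in L^2(0,T;\mathcal V^*)\}$; values $v(0),v(T)$ of $v\in\mathcal W$ are those of its representative in $C([0,T];L^2(\Omega))$. **Continuous problems.** Let $u\in\mathcal W$, $u(0)=u^0$, solve $\int_0^T(\langle\partial_tu,v\rangle+\mathcal B(u,v)+\mathcal N(u;v))\,dt=\int_0^T\langle f,v\rangle\,dt$ for all $v\in L^2(0,T;\mathcal V)$. (That $u$ is a solution includes the integrability in time of $\mathcal N(u;v)$ for all these $v$, and similarly for the term $\mathcal N^s$ below.) **Discretization.** Let $0=t_0<\dots<t_N=T$, $\tau_k=t_k-t_{k-1}$. For a sequence $w_0,\dots,w_N$ let $Iw_\tau$ be its continuous piecewise linear interpolant, $Iw_\tau=\sum_{k=0}^Nw_k\mathbf N_k(t)$ with the hat functions $\mathbf N_k$ of the grid. Let $f_1,\dots,f_N\in\mathcal V^*$ be approximations of $f$ (for example $f_k=f(t_k)$ or $f_k=\tau_k^{-1}\int_{t_{k-1}}^{t_k}f\,dt$;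 the result holds for any choice), and let $\mathcal S_k=\{v\in\mathcal V: v|_K\in\mathbb P^p(K)\ \forall K\in\mathcal K_k\}$, with meshes $\mathcal K_0,\dots,\mathcal K_N$ of $\Omega$. * $u_\tau$: $u_0=u^0$ in $L^2(\Omega)$ and $u_1,\dots,u_N\in\mathcal V$ satisfy, for $0\le k<N$ and all $v\in\mathcal V$, $$\Big(\tfrac{u_{k+1}-u_k}{\tau_{k+1}},v\Big)+\mathcal B(u_{k+1},v)+\mathcal N_c(u_{k+1};v)-\mathcal N_e(u_k;v)=\langle f_{k+1},v\rangle.$$ * $u_{\tau h}$: $u_k^h\in\mathcal S_k$ ($0\le k\le N$), $(u_0^h,v)=(u^0,v)$ for all $v\in\mathcal S_0$, and the same scheme, with $u^h_k,u^h_{k+1}$ in place of $u_k,u_{k+1}$, holds for all $v\in\mathcal S_{k+1}$. * $z\in\mathcal W$, $z(T)=\bar q$, solves the dual problem with $\hat u=Iu_{\tau h}$: for all $w\in L^2(0,T;\mathcal V)$, $$\int_0^T\big(-\langle\partial_tz,w\rangle+\mathcal B(z,w)+\mathcal N^s(u,Iu_{\tau h};w,z)\big)\,dt=\int_0^T(q,w)\,dt.$$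 * $z_\tau$: with $q_k=\tau_k^{-1}\int_0^Tq\,\mathbf N_k\,dt$ ($k\ge1$), $q_0=\tau_1^{-1}\int_0^Tq\,\mathbf N_0\,dt$, the $z_0,\dots,z_N\in\mathcal V$ satisfy for all $w\in\mathcal V$ $$-\Big(\tfrac{z_1-z_0}{\tau_1},w\Big)-\mathcal N_e^s(u_0,u_0^h;w,z_1)=(q_0,w),$$ $$-\Big(\tfrac{z_{k+1}-z_k}{\tau_k},w\Big)+\mathcal B(z_k,w)+\mathcal N_c^s(u_k,u_k^h;w,z_k)-\tfrac{\tau_{k+1}}{\tau_k}\mathcal N_e^s(u_k,u_k^h;w,z_{k+1})=(q_k,w)\quad(1\le k\le N-1),$$ $$(z_N,w)+\tau_N\mathcal B(z_N,w)+\tau_N\mathcal N_c^s(u_N,u_N^h;w,z_N)=\tau_N(q_N,w)+(\bar q,w).$$ All these solutions are assumed to exist. **Residuals.** For $v\in\mathcal V$, $0\le k<N$ and $t\in(t_k,t_{k+1}]$ let $$\mathcal R_{\rm PDE}(\hat u(t);v)=\langle f(t),v\rangle-\langle\partial_t\hat u(t),v\rangle-\mathcal B(\hat u(t),v)-\mathcal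 N(\hat u(t);v),$$ $$\langle r_h^{k+1},v\rangle=\langle f_{k+1},v\rangle-\Big(\tfrac{u^h_{k+1}-u^h_k}{\tau_{k+1}},v\Big)-\mathcal B(u^h_{k+1},v)-\mathcal N_c(u^h_{k+1};v)+\mathcal N_e(u^h_k;v),$$ $$\langle r_\tau^{k+1}(t),v\rangle=\mathcal B(u^h_{k+1},v)+\mathcal N_c(u^h_{k+1};v)-\mathcal N_e(u^h_k;v)-\mathcal B(Iu_{\tau h}(t),v)-\mathcal N(Iu_{\tau h}(t);v),$$ $$\langle r_f^{k+1}(t),v\rangle=\langle f(t)-f_{k+1},v\rangle .$$ **Theorem.** The temporal part of the error is $$\mathcal Q(u)-\mathcal Q(Iu_\tau)=\mathcal R_t+\mathrm{Osc},$$ where $$\mathcal R_t=(u^0-u_0^h,z(0)-z_0)+\sum_{k=0}^{N-1}\int_{t_k}^{t_{k+1}}\big\{\mathcal R_{\rm PDE}(Iu_{\tau h}(t);z(t)-z_{k+1})+\langle r_\tau^{k+1}(t),z_{k+1}\rangle\big\}\,dt,$$ $$\mathrm{Osc}=\sum_{k=0}^{N-1}\int_{t_k}^{t_{k+1}}\langle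 r_f^{k+1}(t),z_{k+1}\rangle\,dt,$$ and the spatial part of the error is $$\mathcal Q(Iu_\tau)-\mathcal Q(Iu_{\tau h})=\mathcal R_s(u_{\tau h};z_\tau-v_\tau^h):=(u^0-u_0^h,z_0-v_0^h)+\sum_{k=1}^N\tau_k\langle r_h^k,z_k-v_k^h\rangle$$ for all $v_\tau^h=\{v_k^h\}_{k=0}^N$ with $v_k^h\in\mathcal S_k$. -/

import Mathlib

open MeasureTheory Set
open scoped ContDiff InnerProductSpace

noncomputable section

namespace IMEX

/-- The Lebesgue space `L²(Ω)` of real functions on `Ω ⊆ ℝᵈ`. -/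
abbrev L2 {d : ℕ} (Ω : Set (EuclideanSpace ℝ (Fin d))) : Type :=
  Lp ℝ 2 (volume.restrict Ω)

section Nonlinear

variable {X Y : Type*} [NormedAddCommGroup X] [NormedSpace ℝ X]
  [NormedAddCommGroup Y] [NormedSpace ℝ Y]

/-- The Gâteaux derivative `F'(x)(w, v)` of a semilinear form `F(x; v)` (linear in `v`). -/
def gateaux (F : X → StrongDual ℝ Y) (x w : X) (v : Y) : ℝ :=
  lineDeriv ℝ (fun y => F y v) x w

/-- Smoothness of a semilinear form: it has a Gâteaux derivative everywhere, which is a bounded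
bilinear form `F'(x)(·, ·)` depending continuously on `x` (for fixed arguments). -/
structure ContGateauxDiff (F : X → StrongDual ℝ Y) : Prop where
  differentiable : ∀ (x w : X) (v : Y), LineDifferentiableAt ℝ (fun y => F y v) x w
  bounded_bilinear : ∀ x : X, ∃ L : X →L[ℝ] StrongDual ℝ Y,
    ∀ (w : X) (v : Y), gateaux F x w v = L w v
  continuous : ∀ (w : X) (v : Y), Continuous fun x => gateaux F x w v

/-- The mean-value linearization `F^s(u, û; w, v) = ∫₀¹ F'(s u + (1 - s) û)(w, v) ds`. -/
def meanLin (F : X → StrongDual ℝ Y) (u uhat w : X) (v : Y) : ℝ :=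
  ∫ s in (0 : ℝ)..1, gateaux F (s • u + (1 - s) • uhat) w v

end Nonlinear

/-- The data of the semilinear parabolic problem on `Ω × (0, T]` in a Gelfand triple
`V ⊆ L²(Ω) ⊆ V*`, together with the data `qbar`, `q` of the quantity of interest. -/
structure Problem {d : ℕ} (Ω : Set (EuclideanSpace ℝ (Fin d)))
    (V : Type*) [NormedAddCommGroup V] [InnerProductSpace ℝ V] where
  /-- the continuous embedding `V ⊆ L²(Ω)` -/
  emb : V →L[ℝ] L2 Ω
  emb_injective : Function.Injective emb
  /-- density of `V` in `L²(Ω)`: the adjoint map `L²(Ω) → V*` is an embedding as well -/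
  emb_dense : DenseRange emb
  T : ℝ
  T_pos : 0 < T
  /-- the bounded symmetric bilinear form `𝓑(·, ·)` -/
  B : V →L[ℝ] V →L[ℝ] ℝ
  B_symm : ∀ v w, B v w = B w v
  /-- the contractive (implicit) part `𝓝_c(·; ·)` of the nonlinearity, on `V × V` -/
  Nc : V → StrongDual ℝ V
  Nc_smooth : ContGateauxDiff Nc
  /-- the expansive (explicit) part `𝓝_e(·; ·)` of the nonlinearity, on `L²(Ω) × L²(Ω)` -/
  Ne : L2 Ω → StrongDual ℝ (L2 Ω)
  Ne_smooth : ContGateauxDiff Ne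
  /-- the source `f ∈ L²(0, T; V*)` -/
  f : ℝ → StrongDual ℝ V
  f_mem : MemLp f 2 (volume.restrict (Ioc 0 T))
  /-- the initial datum `u⁰ ∈ L²(Ω)` -/
  u0 : L2 Ω
  qbar : L2 Ω
  /-- the density `q ∈ L²(0, T; L²(Ω))` -/
  q : ℝ → L2 Ω
  q_mem : MemLp q 2 (volume.restrict (Ioc 0 T))

/-- A time grid `0 = t₀ < t₁ < ⋯ < t_N = T`; the values `node k`, `k > N`, are not used. -/
structure TimeGrid (T : ℝ) where
  N : ℕ
  node : ℕ → ℝ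
  node_zero : node 0 = 0
  node_last : node N = T
  node_lt : ∀ k < N, node k < node (k + 1)

namespace TimeGrid

variable {T : ℝ} (G : TimeGrid T)

/-- The step size `τ_k = t_k - t_{k-1}`, for `k ≥ 1`. -/
def tau (k : ℕ) : ℝ := G.node k - G.node (k - 1)

open Classical in
/-- The hat function `𝐍_k`. -/
def hat (k : ℕ) (t : ℝ) : ℝ :=
  if k < G.N ∧ t ∈ Icc (G.node k) (G.node (k + 1)) then
    (G.node (k + 1) - t) / G.tau (k + 1)
  else if 1 ≤ k ∧ t ∈ Icc (G.node (k - 1)) (G.node k) then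
    (t - G.node (k - 1)) / G.tau k
  else 0

/-- The piecewise linear time reconstruction `I w_τ` of `w_0, …, w_N`. -/
def interp {X : Type*} [AddCommGroup X] [Module ℝ X] (w : ℕ → X) (t : ℝ) : X :=
  ∑ k ∈ Finset.range (G.N + 1), G.hat k t • w k

end TimeGrid

/-- A mesh of `Ω`: finitely many compact cells with nonempty, pairwise disjoint interiors that
cover the closure of `Ω`. (A single such mesh is always shape-regular with some constant.) -/
structure Mesh {d : ℕ} (Ω : Set (EuclideanSpace ℝ (Fin d))) where
  cells : Set (Set (EuclideanSpace ℝ (Fin d)))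
  finite : cells.Finite
  isCompact : ∀ K ∈ cells, IsCompact K
  interior_nonempty : ∀ K ∈ cells, (interior K).Nonempty
  interior_disjoint : cells.Pairwise fun K L => Disjoint (interior K) (interior L)
  cover : ⋃₀ cells = closure Ω

namespace Problem

variable {d : ℕ} {Ω : Set (EuclideanSpace ℝ (Fin d))} {V : Type*}
  [NormedAddCommGroup V] [InnerProductSpace ℝ V] (P : Problem Ω V)

/-- The full nonlinearity `𝓝(u; v) = 𝓝_c(u; v) - 𝓝_e(u; v)` on `V × V`. -/
def Nl (u : V) : StrongDual ℝ V := P.Nc u - (P.Ne (P.emb u)).comp P.emb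

/-- Membership in the Bochner space `L²(0, T; X)`. -/
def MemL2 {X : Type*} [NormedAddCommGroup X] (v : ℝ → X) : Prop :=
  MemLp v 2 (volume.restrict (Ioc 0 P.T))

/-- `g = ∂ₜ v` in the sense of `V*`-valued distributions on `(0, T)`. -/
def IsWeakTimeDeriv (v : ℝ → V) (g : ℝ → StrongDual ℝ V) : Prop :=
  ∀ φ : ℝ → ℝ, ContDiff ℝ ∞ φ → HasCompactSupport φ → tsupport φ ⊆ Ioo 0 P.T → ∀ w : V,
    ∫ t in (0 : ℝ)..P.T, deriv φ t * ⟪P.emb (v t), P.emb w⟫_ℝ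
      = -∫ t in (0 : ℝ)..P.T, φ t * g t w

/-- `c` is the continuous representative `[0, T] → L²(Ω)` of `v`. -/
def IsContRep (v : ℝ → V) (c : ℝ → L2 Ω) : Prop :=
  ContinuousOn c (Icc 0 P.T) ∧ ∀ᵐ t ∂volume.restrict (Ioc 0 P.T), P.emb (v t) = c t

open Classical in
/-- The continuous representative of `v` (unique on `[0, T]`), through which the values `v(0)`,
`v(T)` are understood. -/
def contRep (v : ℝ → V) : ℝ → L2 Ω :=
  if h : ∃ c, P.IsContRep v c then h.choose else 0

/-- `v(s) = a` in `L²(Ω)`, in the sense of the continuous representative. -/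
def HasValue (v : ℝ → V) (s : ℝ) (a : L2 Ω) : Prop :=
  ∃ c, P.IsContRep v c ∧ c s = a

/-- `u` is a weak solution: `u ∈ L²(0,T;V)`, `∂ₜ u ∈ L²(0,T;V*)`, `u(0) = u⁰`, and the weak form
holds (with `t ↦ 𝓝(u(t); v(t))` integrable) for all `v ∈ L²(0,T;V)`. -/
def IsPrimalSolution (u : ℝ → V) : Prop :=
  P.MemL2 u ∧ P.HasValue u 0 P.u0 ∧
  ∃ du : ℝ → StrongDual ℝ V, P.MemL2 du ∧ P.IsWeakTimeDeriv u du ∧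
    ∀ v : ℝ → V, P.MemL2 v →
      IntervalIntegrable (fun t => P.Nl (u t) (v t)) volume 0 P.T ∧
      ∫ t in (0 : ℝ)..P.T, (du t (v t) + P.B (u t) (v t) + P.Nl (u t) (v t))
        = ∫ t in (0 : ℝ)..P.T, P.f t (v t)

/-- `z` is a weak solution of the backward dual problem linearized between `u` and `û`:
`z ∈ L²(0,T;V)`, `∂ₜ z ∈ L²(0,T;V*)`, `z(T) = qbar`, and the weak form holds for all
`w ∈ L²(0,T;V)`. -/
def IsDualSolution (u uhat z : ℝ → V) : Prop :=
  P.MemL2 z ∧ P.HasValue z P.T P.qbar ∧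
  ∃ dz : ℝ → StrongDual ℝ V, P.MemL2 dz ∧ P.IsWeakTimeDeriv z dz ∧
    ∀ w : ℝ → V, P.MemL2 w →
      IntervalIntegrable (fun t => meanLin P.Nl (u t) (uhat t) (w t) (z t)) volume 0 P.T ∧
      ∫ t in (0 : ℝ)..P.T,
          (-(dz t (w t)) + P.B (z t) (w t) + meanLin P.Nl (u t) (uhat t) (w t) (z t))
        = ∫ t in (0 : ℝ)..P.T, ⟪P.q t, P.emb (w t)⟫_ℝ

/-- The quantity of interest `𝓠(w) = (qbar, w(T)) + ∫₀ᵀ (q, w) dt` of an `L²(Ω)`-valued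
trajectory. -/
def Q (w : ℝ → L2 Ω) : ℝ :=
  ⟪P.qbar, w P.T⟫_ℝ + ∫ t in (0 : ℝ)..P.T, ⟪P.q t, w t⟫_ℝ

/-- The conforming finite element space: the `v ∈ V` that agree on each cell with a polynomial
of total degree at most `p`. -/
def femSpace (M : Mesh Ω) (p : ℕ) : Submodule ℝ V where
  carrier := {v | ∀ K ∈ M.cells, ∃ R : MvPolynomial (Fin d) ℝ, R.totalDegree ≤ p ∧
    ∀ᵐ x ∂(volume.restrict Ω).restrict K,
      (P.emb v : EuclideanSpace ℝ (Fin d) → ℝ) x = MvPolynomial.eval (fun i => x i) R}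
  zero_mem' := by
    intro K _
    refine ⟨0, by simp, ?_⟩
    have h := ae_restrict_of_ae (s := K) (Lp.coeFn_zero ℝ 2 (volume.restrict Ω))
    filter_upwards [h] with x hx
    rw [map_zero, hx]
    simp
  add_mem' := by
    intro a b ha hb K hK
    obtain ⟨R, hR, hRa⟩ := ha K hK
    obtain ⟨S, hS, hSb⟩ := hb K hK
    refine ⟨R + S, (MvPolynomial.totalDegree_add _ _).trans (max_le hR hS), ?_⟩
    have h := ae_restrict_of_ae (s := K) (Lp.coeFn_add (P.emb a) (P.emb b))
    filter_upwards [h, hRa, hSb] with x hx h1 h2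
    rw [map_add, hx, Pi.add_apply, h1, h2, map_add]
  smul_mem' := by
    intro c a ha K hK
    obtain ⟨R, hR, hRa⟩ := ha K hK
    refine ⟨c • R, (MvPolynomial.totalDegree_smul_le _ _).trans hR, ?_⟩
    have h := ae_restrict_of_ae (s := K) (Lp.coeFn_smul c (P.emb a))
    filter_upwards [h, hRa] with x hx h1
    rw [map_smul, hx, Pi.smul_apply, h1, MvPolynomial.smul_eval, smul_eq_mul]

/-- The `L²(Ω)`-valued sequence `u_0, ι u_1, ι u_2, …`: the time-discrete initial value `u_0` lies
in `L²(Ω)` only, the later values in `V`. -/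
def levels (a : L2 Ω) (u : ℕ → V) : ℕ → L2 Ω
  | 0 => a
  | k + 1 => P.emb (u (k + 1))

variable (G : TimeGrid P.T)

/-- `u_0 = a ∈ L²(Ω)`, `u_1, …, u_N ∈ V` solve the time-discrete IMEX scheme with source
approximations `f_1, …, f_N`. (The value `u 0` is not used.) -/
def IsTimeDiscreteSolution (fk : ℕ → StrongDual ℝ V) (a : L2 Ω) (u : ℕ → V) : Prop :=
  (∀ v : L2 Ω, ⟪a, v⟫_ℝ = ⟪P.u0, v⟫_ℝ) ∧
  ∀ k < G.N, ∀ v : V,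
    ⟪(G.tau (k + 1))⁻¹ • (P.levels a u (k + 1) - P.levels a u k), P.emb v⟫_ℝ
      + P.B (u (k + 1)) v + P.Nc (u (k + 1)) v - P.Ne (P.levels a u k) (P.emb v)
      = fk (k + 1) v

/-- `u^h_0, …, u^h_N` solve the fully discrete IMEX scheme in the spaces `S_0, …, S_N`. -/
def IsFullyDiscreteSolution (fk : ℕ → StrongDual ℝ V) (S : ℕ → Submodule ℝ V)
    (uh : ℕ → V) : Prop :=
  (∀ k ≤ G.N, uh k ∈ S k) ∧
  (∀ v ∈ S 0, ⟪P.emb (uh 0), P.emb v⟫_ℝ = ⟪P.u0, P.emb v⟫_ℝ) ∧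
  ∀ k < G.N, ∀ v ∈ S (k + 1),
    ⟪P.emb ((G.tau (k + 1))⁻¹ • (uh (k + 1) - uh k)), P.emb v⟫_ℝ
      + P.B (uh (k + 1)) v + P.Nc (uh (k + 1)) v - P.Ne (P.emb (uh k)) (P.emb v)
      = fk (k + 1) v

/-- The discrete goal densities `q_k = τ_k⁻¹ ∫₀ᵀ q 𝐍_k dt` for `k ≥ 1` and
`q_0 = τ_1⁻¹ ∫₀ᵀ q 𝐍_0 dt`. -/
def qk (k : ℕ) : L2 Ω :=
  (G.tau (max k 1))⁻¹ • ∫ t in (0 : ℝ)..P.T, G.hat k t • P.q t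

/-- `z_0, …, z_N` solve the IMEX time-discrete dual problem linearized between
`u_τ = (a, u_1, …, u_N)` and `u_τh`. -/
def IsTimeDiscreteDualSolution (a : L2 Ω) (u uh z : ℕ → V) : Prop :=
  (∀ w : V,
    -⟪P.emb ((G.tau 1)⁻¹ • (z 1 - z 0)), P.emb w⟫_ℝ
      - meanLin P.Ne a (P.emb (uh 0)) (P.emb w) (P.emb (z 1))
      = ⟪P.qk G 0, P.emb w⟫_ℝ) ∧
  (∀ k, 1 ≤ k → k < G.N → ∀ w : V,
    -⟪P.emb ((G.tau k)⁻¹ • (z (k + 1) - z k)), P.emb w⟫_ℝ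
      + P.B (z k) w + meanLin P.Nc (u k) (uh k) w (z k)
      - G.tau (k + 1) / G.tau k *
          meanLin P.Ne (P.emb (u k)) (P.emb (uh k)) (P.emb w) (P.emb (z (k + 1)))
      = ⟪P.qk G k, P.emb w⟫_ℝ) ∧
  ∀ w : V,
    ⟪P.emb (z G.N), P.emb w⟫_ℝ + G.tau G.N * P.B (z G.N) w
      + G.tau G.N * meanLin P.Nc (u G.N) (uh G.N) w (z G.N)
      = G.tau G.N * ⟪P.qk G G.N, P.emb w⟫_ℝ + ⟪P.qbar, P.emb w⟫_ℝ

/-- The residual `𝓡_PDE(û(t); v)` of the primal problem, for `û` piecewise smooth in time. -/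
def resPDE (uhat : ℝ → V) (t : ℝ) (v : V) : ℝ :=
  P.f t v - ⟪P.emb (deriv uhat t), P.emb v⟫_ℝ - P.B (uhat t) v - P.Nl (uhat t) v

/-- The spatial residual `⟨r_h^{k+1}, v⟩`. -/
def resH (fk : ℕ → StrongDual ℝ V) (uh : ℕ → V) (k : ℕ) (v : V) : ℝ :=
  fk (k + 1) v - ⟪P.emb ((G.tau (k + 1))⁻¹ • (uh (k + 1) - uh k)), P.emb v⟫_ℝ
    - P.B (uh (k + 1)) v - P.Nc (uh (k + 1)) v + P.Ne (P.emb (uh k)) (P.emb v)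

/-- The temporal residual `⟨r_τ^{k+1}(t), v⟩`. -/
def resTau (uh : ℕ → V) (k : ℕ) (t : ℝ) (v : V) : ℝ :=
  P.B (uh (k + 1)) v + P.Nc (uh (k + 1)) v - P.Ne (P.emb (uh k)) (P.emb v)
    - P.B (G.interp uh t) v - P.Nl (G.interp uh t) v

/-- The data residual `⟨r_f^{k+1}(t), v⟩ = ⟨f(t) - f_{k+1}, v⟩`. -/
def resF (fk : ℕ → StrongDual ℝ V) (k : ℕ) (t : ℝ) (v : V) : ℝ :=
  (P.f t - fk (k + 1)) v

/-- The spatial error representation `𝓡_s(u_τh; y_τ)`. -/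
def spatialRep (fk : ℕ → StrongDual ℝ V) (uh y : ℕ → V) : ℝ :=
  ⟪P.u0 - P.emb (uh 0), P.emb (y 0)⟫_ℝ
    + ∑ k ∈ Finset.range G.N, G.tau (k + 1) * P.resH G fk uh k (y (k + 1))

/-- The temporal error representation `𝓡_t(u_τh, u_τ, z, z_τ)`; here `u_τ` enters only through
`z_τ`. -/
def temporalRep (uh : ℕ → V) (z : ℝ → V) (zk : ℕ → V) : ℝ :=
  ⟪P.u0 - P.emb (uh 0), P.contRep z 0 - P.emb (zk 0)⟫_ℝ
    + ∑ k ∈ Finset.range G.N, ∫ t in (G.node k)..(G.node (k + 1)),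
        (P.resPDE (G.interp uh) t (z t - zk (k + 1)) + P.resTau G uh k t (zk (k + 1)))

/-- The data oscillation `Osc`. -/
def osc (fk : ℕ → StrongDual ℝ V) (zk : ℕ → V) : ℝ :=
  ∑ k ∈ Finset.range G.N, ∫ t in (G.node k)..(G.node (k + 1)), P.resF fk k t (zk (k + 1))

end Problem

end IMEX

end

/-!
Both error identities come from testing a dual problem with the error and the primal problem with
the dual solution. The linearization `𝓝ˢ(u, û; u - û, z)` equals `𝓝(u; z) - 𝓝(û; z)` by the mean
value theorem (`meanLin_sub_eq`), so the nonlinear terms match exactly and no remainder appears.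

*Spatial part.* The discrete dual equations, tested with the errors `e_k = u_k - u_k^h` and summed
by parts in time, give the spatial residuals tested with `z_k` (`Q_interp_sub_Q_interp_eq`). The
initial error `e_0` lies in `L²(Ω)` only; the first dual equation extends to it by density of `V`,
because `𝓝_eˢ` is bounded in its direction by the Banach–Steinhaus theorem (`initial_eq`). Galerkin
orthogonality allows for subtracting `v_k^h` (`spatialRep_sub`).

*Temporal part.* The continuous dual problem gives
`𝓠(u) - 𝓠(Iu_τh) = (u⁰ - u_0^h, z(0)) + ∫ 𝓡_PDE(Iu_τh; z) dt` (`Q_sub_Q_interp_eq`). Since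
`𝓡_PDE = r_h + r_τ + r_f` on each time step, where `r_h` is constant in time, the difference of this
and the spatial identity with `v^h = 0` is the temporal one (`temporalRep_add_osc_eq`).

The analytic ingredient is the integration by parts `∫ ⟨∂ₜu, z⟩ + ⟨∂ₜz, u⟩ = [(u, z)]` in a Gelfand
triple (`inner_sub_inner_eq_integral`). Given the continuous representatives, the du Bois-Reymond
lemma turns the weak derivatives into `(c(b) - c(a), w) = ∫ₐᵇ g w`; then the averaged difference
quotients of `(u, z)` are integrals of Steklov averages, which converge because translation is
continuous in `L²`.
-/

noncomputable section

namespace IMEX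

/-! ### Weak derivatives on an interval -/

/-- A smooth function of integral zero, compactly supported in `(0, T)`, is the derivative of a
test function on `(0, T)`. -/
lemma exists_testFunction_deriv_eq {T : ℝ} {η : ℝ → ℝ} (hη : ContDiff ℝ ∞ η)
    (hc : HasCompactSupport η) (hs : tsupport η ⊆ Ioo 0 T) (hint : ∫ t, η t = 0) :
    ∃ φ : ℝ → ℝ, ContDiff ℝ ∞ φ ∧ HasCompactSupport φ ∧ tsupport φ ⊆ Ioo 0 T ∧ deriv φ = η := by
  have hd : ∀ t, HasDerivAt (fun t => ∫ s in (0 : ℝ)..t, η s) (η t) t := fun t =>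
    hη.continuous.integral_hasStrictDerivAt 0 t |>.hasDerivAt
  have hderiv : deriv (fun t => ∫ s in (0 : ℝ)..t, η s) = η := funext fun t => (hd t).deriv
  obtain ⟨a, b, ha, hb, hab⟩ : ∃ a b, 0 < a ∧ b < T ∧ tsupport η ⊆ Icc a b := by
    rcases (tsupport η).eq_empty_or_nonempty with h | h
    · exact ⟨1, T - 1, by norm_num, by linarith, by simp [h]⟩
    · obtain ⟨a, ha⟩ := hc.isCompact.exists_isLeast h
      obtain ⟨b, hb⟩ := hc.isCompact.exists_isGreatest h
      exact ⟨a, b, (hs ha.1).1, (hs hb.1).2, fun x hx => ⟨ha.2 hx, hb.2 hx⟩⟩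
  have hz : ∀ s, s ∉ Icc a b → η s = 0 := fun s hsn => by
    by_contra h
    exact hsn (hab (subset_tsupport _ h))
  have hsupp : Function.support (fun t => ∫ s in (0 : ℝ)..t, η s) ⊆ Icc a b := by
    intro t ht
    by_contra hn
    apply ht
    simp only [mem_Icc, not_and_or, not_le] at hn
    rcases hn with hn | hn
    · apply intervalIntegral.integral_zero_ae
      refine Filter.Eventually.of_forall fun s hs' => hz s fun hmem => ?_
      rcases mem_uIoc.1 hs' with h | h <;> linarith [hmem.1, h.2]
    · change ∫ s in (0 : ℝ)..t, η s = 0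
      rw [intervalIntegral.integral_eq_integral_of_support_subset, hint]
      intro s hs'
      have hmem : s ∈ Icc a b := hab (subset_tsupport _ hs')
      exact ⟨by linarith [hmem.1], by linarith [hmem.2]⟩
  have hts : tsupport (fun t => ∫ s in (0 : ℝ)..t, η s) ⊆ Icc a b :=
    closure_minimal hsupp isClosed_Icc
  refine ⟨_, ?_, HasCompactSupport.of_support_subset_isCompact isCompact_Icc hsupp,
    hts.trans fun x hx => ⟨lt_of_lt_of_le ha hx.1, lt_of_le_of_lt hx.2 hb⟩, hderiv⟩
  rw [contDiff_infty_iff_deriv, hderiv]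
  exact ⟨fun t => (hd t).differentiableAt, hη⟩

lemma intervalIntegral_eq_integral_of_eq_zero {T : ℝ} {f : ℝ → ℝ}
    (hs : ∀ t, t ∉ Ioo (0 : ℝ) T → f t = 0) : ∫ t in (0 : ℝ)..T, f t = ∫ t, f t := by
  apply intervalIntegral.integral_eq_integral_of_support_subset
  intro t ht
  by_contra h
  exact ht (hs t fun h' => h (Ioo_subset_Ioc_self h'))

/-- The lemma of du Bois-Reymond: a continuous function whose weak derivative vanishes is
constant. -/
lemma eqOn_const_of_forall_integral_deriv_mul_eq_zero {T : ℝ} (hT : 0 < T) {H : ℝ → ℝ}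
    (hH : ContinuousOn H (Icc 0 T))
    (h : ∀ φ : ℝ → ℝ, ContDiff ℝ ∞ φ → HasCompactSupport φ → tsupport φ ⊆ Ioo 0 T →
      ∫ t in (0 : ℝ)..T, deriv φ t * H t = 0) :
    ∀ t ∈ Icc 0 T, H t = H 0 := by
  obtain ⟨ψ₀, hψ₀, hψ₀c, hψ₀s, hψ₀i⟩ : ∃ ψ : ℝ → ℝ, ContDiff ℝ ∞ ψ ∧ HasCompactSupport ψ ∧
      tsupport ψ ⊆ Ioo 0 T ∧ ∫ t, ψ t = 1 := by
    let b : ContDiffBump (T / 2) := ⟨T / 8, T / 4, by linarith, by linarith⟩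
    refine ⟨b.normed volume, b.contDiff_normed, b.hasCompactSupport_normed, ?_,
      b.integral_normed⟩
    rw [b.tsupport_normed_eq, Real.closedBall_eq_Icc]
    intro x hx
    have h1 : T / 2 - T / 4 ≤ x := hx.1
    have h2 : x ≤ T / 2 + T / 4 := hx.2
    exact ⟨by linarith, by linarith⟩
  have hint : ∀ ψ : ℝ → ℝ, Continuous ψ → IntervalIntegrable (fun t => ψ t * H t) volume 0 T :=
    fun ψ hψ => (ContinuousOn.mul hψ.continuousOn
      (by rwa [uIcc_of_le hT.le])).intervalIntegrable
  set c := ∫ t in (0 : ℝ)..T, ψ₀ t * H t with hc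
  have hvan : ∀ ψ : ℝ → ℝ, tsupport ψ ⊆ Ioo 0 T → ∀ t ∉ Ioo (0 : ℝ) T, ψ t = 0 :=
    fun ψ hψ t ht => by
      by_contra h'
      exact ht (hψ (subset_tsupport _ h'))
  have key : ∀ ψ : ℝ → ℝ, ContDiff ℝ ∞ ψ → HasCompactSupport ψ → tsupport ψ ⊆ Ioo 0 T →
      ∫ t, ψ t • (H t - c) = 0 := by
    intro ψ hψ hψc hψs
    set m := ∫ t, ψ t with hm
    -- `ψ - m ψ₀` has integral zero, so it is the derivative of a test function.
    have hηc : HasCompactSupport (fun t => ψ t - m * ψ₀ t) := hψc.sub (hψ₀c.mul_left)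
    have hηs : tsupport (fun t => ψ t - m * ψ₀ t) ⊆ Ioo 0 T := by
      refine (tsupport_sub ψ (fun t => m * ψ₀ t)).trans (union_subset hψs ?_)
      exact (tsupport_mul_subset_right).trans hψ₀s
    have hη0 : ∫ t, (ψ t - m * ψ₀ t) = 0 := by
      rw [integral_sub (hψ.continuous.integrable_of_hasCompactSupport hψc)
        ((hψ₀.continuous.integrable_of_hasCompactSupport hψ₀c).const_mul m),
        integral_const_mul, hψ₀i, mul_one, sub_self]
    obtain ⟨φ, h1, h2, h3, h4⟩ := exists_testFunction_deriv_eq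
      (hψ.sub (contDiff_const.mul hψ₀)) hηc hηs hη0
    have h5 := h φ h1 h2 h3
    rw [h4] at h5
    rw [← intervalIntegral_eq_integral_of_eq_zero
      (fun t ht => by rw [hvan ψ hψs t ht, zero_smul])]
    have h6 : ∫ t in (0 : ℝ)..T, ψ t = m :=
      intervalIntegral_eq_integral_of_eq_zero (hvan ψ hψs)
    have e1 : (∫ t in (0 : ℝ)..T, ψ t • (H t - c))
        = (∫ t in (0 : ℝ)..T, ψ t * H t) - m * c := by
      rw [← h6, ← intervalIntegral.integral_mul_const,
        ← intervalIntegral.integral_sub (hint ψ hψ.continuous)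
        ((show Continuous fun t => ψ t * c from
          hψ.continuous.mul continuous_const).intervalIntegrable _ _)]
      congr 1
      ext t
      simp only [smul_eq_mul]
      ring
    have e2 : (∫ t in (0 : ℝ)..T, (ψ t - m * ψ₀ t) * H t)
        = (∫ t in (0 : ℝ)..T, ψ t * H t) - m * c := by
      rw [hc, ← intervalIntegral.integral_const_mul,
        ← intervalIntegral.integral_sub (hint ψ hψ.continuous)
        ((hint ψ₀ hψ₀.continuous).const_mul m)]
      congr 1
      ext t
      ring
    rw [e1, ← e2, h5]
  have hloc : LocallyIntegrableOn (fun t => H t - c) (Ioo 0 T) volume :=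
    ((hH.sub continuousOn_const).mono Ioo_subset_Icc_self).locallyIntegrableOn
      measurableSet_Ioo
  have hae := isOpen_Ioo.ae_eq_zero_of_integral_contDiff_smul_eq_zero hloc key
  have hEq : EqOn H (fun _ => c) (Icc 0 T) := by
    refine Measure.eqOn_Icc_of_ae_eq volume hT.ne ?_ hH continuousOn_const
    rw [← restrict_Ioo_eq_restrict_Icc, Filter.EventuallyEq, ae_restrict_iff' measurableSet_Ioo]
    filter_upwards [hae] with t ht hm
    linarith [ht hm]
  intro t ht
  rw [hEq ht, hEq (left_mem_Icc.2 hT.le)]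

/-- A continuous function with an integrable weak derivative is the primitive of it. -/
lemma sub_eq_integral_of_weakDeriv {T : ℝ} (hT : 0 < T) {F g : ℝ → ℝ}
    (hF : ContinuousOn F (Icc 0 T)) (hg : IntervalIntegrable g volume 0 T)
    (h : ∀ φ : ℝ → ℝ, ContDiff ℝ ∞ φ → HasCompactSupport φ → tsupport φ ⊆ Ioo 0 T →
      ∫ t in (0 : ℝ)..T, deriv φ t * F t = -∫ t in (0 : ℝ)..T, φ t * g t) :
    ∀ a ∈ Icc 0 T, ∀ b ∈ Icc 0 T, F b - F a = ∫ t in a..b, g t := by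
  have hG := hg.absolutelyContinuousOnInterval_intervalIntegral (c := 0) (by simp)
  have hGc : ContinuousOn (fun t => ∫ s in (0 : ℝ)..t, g s) (Icc 0 T) := by
    simpa [uIcc_of_le hT.le] using hG.continuousOn
  have hGd : ∀ᵐ t, t ∈ uIoc 0 T → deriv (fun t => ∫ s in (0 : ℝ)..t, g s) t = g t := by
    filter_upwards [hg.ae_hasDerivAt_integral] with t ht hm
    exact (ht (uIoc_subset_uIcc hm) 0 left_mem_uIcc).deriv
  -- The hypothesis says that `F` minus the primitive of `g` has weak derivative zero.
  have hcst := eqOn_const_of_forall_integral_deriv_mul_eq_zero hT (hF.sub hGc) (by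
    intro φ h1 h2 h3
    have hφ0 : φ 0 = 0 ∧ φ T = 0 := by
      constructor <;>
      · by_contra h'
        have := h3 (subset_tsupport _ h')
        simp at this
    have hφd : Continuous (deriv φ) := h1.continuous_deriv (by simp)
    have hφac : AbsolutelyContinuousOnInterval φ 0 T :=
      ContDiffOn.absolutelyContinuousOnInterval (h1.of_le (by simp)).contDiffOn
    have hibp := hφac.integral_mul_deriv_eq_deriv_mul hG
    rw [hφ0.1, hφ0.2, zero_mul, zero_mul, sub_zero, zero_sub] at hibp
    have e : ∫ t in (0 : ℝ)..T, φ t * deriv (fun t => ∫ s in (0 : ℝ)..t, g s) t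
        = ∫ t in (0 : ℝ)..T, φ t * g t := by
      refine intervalIntegral.integral_congr_ae ?_
      filter_upwards [hGd] with t ht hm
      rw [ht hm]
    rw [e] at hibp
    have i1 : IntervalIntegrable (fun t => deriv φ t * F t) volume 0 T :=
      (hφd.continuousOn.mul (by rwa [uIcc_of_le hT.le])).intervalIntegrable
    have i2 : IntervalIntegrable (fun t => deriv φ t * ∫ s in (0 : ℝ)..t, g s) volume 0 T :=
      (hφd.continuousOn.mul (by rwa [uIcc_of_le hT.le])).intervalIntegrable
    have := h φ h1 h2 h3
    simp only [Pi.sub_apply, mul_sub]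
    rw [intervalIntegral.integral_sub i1 i2, this, hibp, neg_neg, sub_self])
  intro a ha b hb
  have hia : IntervalIntegrable g volume 0 a := hg.mono_set (by
    rw [uIcc_of_le ha.1, uIcc_of_le hT.le]; exact Icc_subset_Icc_right ha.2)
  have hib : IntervalIntegrable g volume 0 b := hg.mono_set (by
    rw [uIcc_of_le hb.1, uIcc_of_le hT.le]; exact Icc_subset_Icc_right hb.2)
  have e1 := hcst a ha
  have e2 := hcst b hb
  simp only [Pi.sub_apply] at e1 e2
  rw [← intervalIntegral.integral_interval_sub_left hib hia]
  linarith

/-! ### Integration by parts in a Gelfand triple -/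

lemma memLp_comp_add_left {E : Type*} [NormedAddCommGroup E] {p : ENNReal} {g : ℝ → E}
    (hg : MemLp g p volume) (s : ℝ) : MemLp (fun t => g (s + t)) p volume :=
  hg.comp_measurePreserving (measurePreserving_add_left volume s)

section Translation

variable {E F : Type*} [NormedAddCommGroup E] [NormedSpace ℝ E]
  [NormedAddCommGroup F] [NormedSpace ℝ F]

/-- Continuity of translation in `L²`, for the product of two `L²` functions: the product of
translates converges in `L¹`. -/
lemma exists_forall_integral_norm_translate_sub_le (B : E →L[ℝ] F →L[ℝ] ℝ) {g : ℝ → E} {f : ℝ → F}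
    (hg : MemLp g 2 volume) (hf : MemLp f 2 volume) {ε : ℝ} (hε : 0 < ε) :
    ∃ δ > 0, ∀ s σ : ℝ, |s| < δ → |σ| < δ →
      ∫ t, ‖B (g (s + t)) (f (σ + t)) - B (g t) (f t)‖ ≤ ε := by
  have : Fact ((2 : ENNReal) ≠ ⊤) := ⟨by simp⟩
  let Φ : ℝ × ℝ → Lp ℝ 1 (volume : Measure ℝ) := fun x =>
    B.holderL volume 2 2 1 (DomAddAct.mk x.1 +ᵥ hg.toLp g) (DomAddAct.mk x.2 +ᵥ hf.toLp f)
  have hΦ : Continuous Φ := by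
    have h1 : Continuous fun x : ℝ × ℝ => DomAddAct.mk x.1 +ᵥ hg.toLp g := by fun_prop
    have h2 : Continuous fun x : ℝ × ℝ => DomAddAct.mk x.2 +ᵥ hf.toLp f := by fun_prop
    exact ((B.holderL volume 2 2 1).continuous.comp h1).clm_apply h2
  have hae : ∀ x : ℝ × ℝ, Φ x =ᵐ[volume] fun t => B (g (x.1 + t)) (f (x.2 + t)) := by
    intro x
    have h0 : Φ x = B.holder 1 ((memLp_comp_add_left hg x.1).toLp _)
      ((memLp_comp_add_left hf x.2).toLp _) := rfl
    rw [h0]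
    filter_upwards [B.coeFn_holder (r := 1) ((memLp_comp_add_left hg x.1).toLp _)
      ((memLp_comp_add_left hf x.2).toLp _), (memLp_comp_add_left hg x.1).coeFn_toLp,
      (memLp_comp_add_left hf x.2).coeFn_toLp] with t h1 h2 h3
    rw [h1, h2, h3]
  obtain ⟨δ, hδ, h⟩ := Metric.continuous_iff.1 hΦ 0 ε hε
  refine ⟨δ, hδ, fun s σ hs hσ => ?_⟩
  have h1 := h (s, σ) (by
    rw [dist_zero_right, Prod.norm_def]
    exact max_lt hs hσ)
  rw [dist_eq_norm, L1.norm_eq_integral_norm] at h1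
  refine le_trans (le_of_eq (integral_congr_ae ?_)) h1.le
  filter_upwards [hae (s, σ), hae 0, Lp.coeFn_sub (Φ (s, σ)) (Φ 0)] with t h2 h3 h4
  rw [h4, Pi.sub_apply, h2, h3]
  simp

lemma integrable_translate (B : E →L[ℝ] F →L[ℝ] ℝ) {g : ℝ → E} {f : ℝ → F}
    (hg : MemLp g 2 volume) (hf : MemLp f 2 volume) (s σ : ℝ) :
    Integrable (fun t => B (g (s + t)) (f (σ + t))) volume :=
  memLp_one_iff_integrable.1
    (B.memLp_of_bilin 1 (memLp_comp_add_left hg s) (memLp_comp_add_left hf σ))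

lemma aestronglyMeasurable_translate (B : E →L[ℝ] F →L[ℝ] ℝ) {g : ℝ → E} {f : ℝ → F}
    (hg : AEStronglyMeasurable g volume) (hf : AEStronglyMeasurable f volume) (σ : ℝ) :
    AEStronglyMeasurable (fun x : ℝ × ℝ => B (g (x.2 + x.1)) (f (σ + x.1)))
      (volume.prod volume) := by
  have q1 : Measure.QuasiMeasurePreserving (fun x : ℝ × ℝ => x.2 + x.1)
      (volume.prod volume) volume := by
    have := Measure.quasiMeasurePreserving_fst.comp
      (measurePreserving_add_prod (volume : Measure ℝ) volume).quasiMeasurePreserving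
    simpa only [Function.comp_def, add_comm] using this
  have q2 : Measure.QuasiMeasurePreserving (fun x : ℝ × ℝ => σ + x.1)
      (volume.prod volume) volume :=
    (measurePreserving_add_left volume σ).quasiMeasurePreserving.comp
      Measure.quasiMeasurePreserving_fst
  exact B.aestronglyMeasurable_comp₂ (hg.comp_quasiMeasurePreserving q1)
    (hf.comp_quasiMeasurePreserving q2)

/-- Steklov averages: averaging `t ↦ B (g (s + t)) (f (σ + t))` over small translations `s` changes
its integral over any set by little. -/
lemma exists_forall_average_translate_le (B : E →L[ℝ] F →L[ℝ] ℝ) {g : ℝ → E} {f : ℝ → F}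
    (hg : MemLp g 2 volume) (hf : MemLp f 2 volume) {ε : ℝ} (hε : 0 < ε) :
    ∃ δ > 0, ∀ h σ : ℝ, 0 < h → h < δ → |σ| ≤ h → ∀ A : Set ℝ, MeasurableSet A →
      IntegrableOn (fun t => ∫ s in (0 : ℝ)..h, B (g (s + t)) (f (σ + t))) A ∧
      |h⁻¹ * (∫ t in A, ∫ s in (0 : ℝ)..h, B (g (s + t)) (f (σ + t)))
        - ∫ t in A, B (g t) (f t)| ≤ ε := by
  obtain ⟨δ, hδ, H⟩ := exists_forall_integral_norm_translate_sub_le B hg hf hε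
  refine ⟨δ, hδ, fun h σ h0 hh hσ A hA => ?_⟩
  -- By Fubini, the average of the integrals replaces the integral of the averages, and each of the
  -- averaged integrals is within `ε` of the limit.
  have i0 : Integrable (fun t => B (g t) (f t)) volume := by
    simpa using integrable_translate B hg hf 0 0
  have iT := fun s => integrable_translate B hg hf s σ
  have hs : ∀ s ∈ Ioc 0 h, ∫ t, ‖B (g (s + t)) (f (σ + t)) - B (g t) (f t)‖ ≤ ε := fun s hs =>
    H s σ (by rw [abs_of_pos hs.1]; exact hs.2.trans_lt hh) (hσ.trans_lt hh)
  have meas := (aestronglyMeasurable_translate B hg.1 hf.1 σ).restrict (s := univ ×ˢ Ioc 0 h)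
  rw [← Measure.prod_restrict, Measure.restrict_univ] at meas
  have ip : Integrable (fun x : ℝ × ℝ => B (g (x.2 + x.1)) (f (σ + x.1)))
      (volume.prod (volume.restrict (Ioc 0 h))) := by
    rw [integrable_prod_iff' meas]
    refine ⟨Filter.Eventually.of_forall fun s => iT s, ?_⟩
    refine Integrable.of_bound meas.prod_swap.norm.integral_prod_right'
      ((∫ t, ‖B (g t) (f t)‖) + ε) ?_
    rw [ae_restrict_iff' measurableSet_Ioc]
    refine Filter.Eventually.of_forall fun s hs' => ?_
    rw [Real.norm_of_nonneg (integral_nonneg fun _ => norm_nonneg _)]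
    refine le_trans ?_ (add_le_add_right (hs s hs') _)
    have e := integral_add i0.norm ((iT s).sub i0).norm
    simp only [Pi.sub_apply] at e
    rw [← e]
    refine integral_mono (iT s).norm (i0.norm.add ((iT s).sub i0).norm) fun t => ?_
    exact norm_le_norm_add_norm_sub' _ _
  have ipA : Integrable (fun x : ℝ × ℝ => B (g (x.2 + x.1)) (f (σ + x.1)))
      ((volume.restrict A).prod (volume.restrict (Ioc 0 h))) := by
    have := ip.restrict (s := A ×ˢ univ)
    rwa [← Measure.prod_restrict, Measure.restrict_univ] at this
  simp only [intervalIntegral.integral_of_le h0.le]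
  refine ⟨ipA.integral_prod_left, ?_⟩
  rw [integral_integral_swap ipA]
  have e : h⁻¹ * (∫ s in Ioc 0 h, ∫ t in A, B (g (s + t)) (f (σ + t)))
      - ∫ t in A, B (g t) (f t)
      = h⁻¹ * ∫ s in (0 : ℝ)..h, ((∫ t in A, B (g (s + t)) (f (σ + t)))
        - ∫ t in A, B (g t) (f t)) := by
    rw [intervalIntegral.integral_sub _ (by simp), intervalIntegral.integral_const,
      intervalIntegral.integral_of_le h0.le, sub_zero, smul_eq_mul, mul_sub,
      inv_mul_cancel_left₀ h0.ne']
    rw [intervalIntegrable_iff_integrableOn_Ioc_of_le h0.le]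
    exact ipA.integral_prod_right
  rw [e, abs_mul, abs_of_pos (inv_pos.2 h0), inv_mul_le_iff₀ h0]
  have := intervalIntegral.norm_integral_le_of_norm_le_const (a := 0) (b := h) (C := ε)
    (f := fun s => (∫ t in A, B (g (s + t)) (f (σ + t))) - ∫ t in A, B (g t) (f t)) ?_
  · rw [sub_zero, abs_of_pos h0, mul_comm] at this
    exact this
  · intro s hs'
    rw [uIoc_of_le h0.le] at hs'
    rw [← integral_sub (iT s).integrableOn i0.integrableOn]
    refine (norm_integral_le_integral_norm _).trans (le_trans ?_ (hs s hs'))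
    exact setIntegral_le_integral ((iT s).sub i0).norm
      (Filter.Eventually.of_forall fun _ => norm_nonneg _)

end Translation

section Gelfand

variable {V H : Type*} [NormedAddCommGroup V] [NormedSpace ℝ V]
  [NormedAddCommGroup H] [InnerProductSpace ℝ H]

/-- `g : [0, T] → V*` is the derivative of `c : [0, T] → H` in the integrated sense
`c(b) - c(a) = ∫ₐᵇ g`, an identity in `V*` through the map `j : V → H`. -/
def IsPrimitive (j : V →L[ℝ] H) (T : ℝ) (c : ℝ → H) (g : ℝ → StrongDual ℝ V) : Prop :=
  ∀ a ∈ Icc 0 T, ∀ b ∈ Icc 0 T, ∀ w : V, ⟪c b - c a, j w⟫_ℝ = ∫ s in a..b, g s w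

lemma IsPrimitive.inner_add_sub_eq {j : V →L[ℝ] H} {T : ℝ} {c : ℝ → H} {g : ℝ → StrongDual ℝ V}
    (hc : IsPrimitive j T c g) {t h : ℝ} (h0 : 0 < h) (ht : t ∈ Ioc 0 (T - h)) (w : V) :
    ⟪c (t + h) - c t, j w⟫_ℝ
      = ∫ s in (0 : ℝ)..h, (Ioc 0 T).indicator g (s + t) w := by
  rw [hc t ⟨ht.1.le, by linarith [ht.2]⟩ (t + h) ⟨by linarith [ht.1], by linarith [ht.2]⟩ w,
    intervalIntegral.integral_comp_add_right (fun s => (Ioc 0 T).indicator g s w), zero_add,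
    add_comm h t]
  refine intervalIntegral.integral_congr_ae (Filter.Eventually.of_forall fun s hs => ?_)
  rw [uIoc_of_le (by linarith)] at hs
  have hm : s ∈ Ioc 0 T := ⟨by linarith [hs.1, ht.1], by linarith [hs.2, ht.2]⟩
  rw [indicator_of_mem hm]

/-- The end values of a continuous function are limits of its averages over short intervals. -/
lemma tendsto_inv_mul_integral_sub {T : ℝ} {F : ℝ → ℝ} (hF : Continuous F) :
    Filter.Tendsto (fun h : ℝ => h⁻¹ * ∫ t in (0 : ℝ)..(T - h), (F (t + h) - F t))
      (nhdsWithin 0 (Ioi 0)) (nhds (F T - F 0)) := by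
  have hii : ∀ a b, IntervalIntegrable F volume a b := fun a b => hF.intervalIntegrable a b
  have d2 : HasDerivAt (fun x : ℝ => ∫ t in (0 : ℝ)..x, F t) (F 0) (0 : ℝ) :=
    (hF.integral_hasStrictDerivAt 0 0).hasDerivAt
  have d3 : HasDerivAt (fun x : ℝ => ∫ t in (0 : ℝ)..x, F t) (F T) (T - 0) := by
    rw [sub_zero]
    exact (hF.integral_hasStrictDerivAt 0 T).hasDerivAt
  have d4 : HasDerivAt (fun h : ℝ => ∫ t in (0 : ℝ)..(T - h), F t) (-F T) (0 : ℝ) := by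
    simpa using d3.comp_const_sub T 0
  have d := (d2.add d4).tendsto_slope_zero_right
  have d' := d.neg
  rw [show -(F 0 + -F T) = F T - F 0 by ring] at d'
  refine d'.congr' ?_
  filter_upwards [self_mem_nhdsWithin] with h hh
  simp only [Pi.add_apply, zero_add, sub_zero, intervalIntegral.integral_same, smul_eq_mul]
  rw [intervalIntegral.integral_sub
      ((by fun_prop : Continuous fun t => F (t + h)).intervalIntegrable _ _)
    (hii _ _), intervalIntegral.integral_comp_add_right, zero_add, sub_add_cancel,
    ← intervalIntegral.integral_interval_sub_left (hii 0 T) (hii 0 h)]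
  ring

/-- The difference quotient of `t ↦ (c₁(t), c₂(t))` is the sum of the Steklov averages of
`⟨g₁, v₂⟩` and `⟨g₂, v₁⟩`. -/
lemma IsPrimitive.inner_sub_inner_eq {j : V →L[ℝ] H} {T : ℝ}
    {v₁ v₂ : ℝ → V} {g₁ g₂ : ℝ → StrongDual ℝ V} {c₁ c₂ : ℝ → H}
    (hp₁ : IsPrimitive j T c₁ g₁) (hp₂ : IsPrimitive j T c₂ g₂) {t h : ℝ} (h0 : 0 < h)
    (ht : t ∈ Ioc 0 (T - h)) (e₁ : j (v₁ t) = c₁ t) (e₂ : j (v₂ (h + t)) = c₂ (h + t)) :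
    ⟪c₁ (t + h), c₂ (t + h)⟫_ℝ - ⟪c₁ t, c₂ t⟫_ℝ
      = (∫ s in (0 : ℝ)..h, (Ioc 0 T).indicator g₁ (s + t) ((Ioc 0 T).indicator v₂ (h + t)))
        + ∫ s in (0 : ℝ)..h, (Ioc 0 T).indicator g₂ (s + t) ((Ioc 0 T).indicator v₁ (0 + t)) := by
  have m1 : t ∈ Ioc 0 T := ⟨ht.1, by linarith [ht.2]⟩
  have m2 : h + t ∈ Ioc 0 T := ⟨by linarith [ht.1], by linarith [ht.2]⟩
  rw [zero_add, indicator_of_mem m1, indicator_of_mem m2, ← hp₁.inner_add_sub_eq h0 ht,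
    ← hp₂.inner_add_sub_eq h0 ht, e₁, e₂, add_comm h t, real_inner_comm (c₁ t),
    inner_sub_left, inner_sub_right]
  ring

lemma integrable_dual_apply {T : ℝ} {g : ℝ → StrongDual ℝ V} {v : ℝ → V}
    (hg : MemLp g 2 (volume.restrict (Ioc 0 T))) (hv : MemLp v 2 (volume.restrict (Ioc 0 T))) :
    Integrable (fun t => g t (v t)) (volume.restrict (Ioc 0 T)) :=
  memLp_one_iff_integrable.1
    ((ContinuousLinearMap.id ℝ (StrongDual ℝ V)).memLp_of_bilin 1 hg hv)

lemma exists_forall_average_dual_translate_le {T : ℝ} {g : ℝ → StrongDual ℝ V} {v : ℝ → V}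
    (hg : MemLp g 2 (volume.restrict (Ioc 0 T))) (hv : MemLp v 2 (volume.restrict (Ioc 0 T)))
    {ε : ℝ} (hε : 0 < ε) :
    ∃ δ > 0, ∀ h σ : ℝ, 0 < h → h < δ → |σ| ≤ h → ∀ b ≤ T,
      IntegrableOn (fun t => ∫ s in (0 : ℝ)..h,
        (Ioc 0 T).indicator g (s + t) ((Ioc 0 T).indicator v (σ + t))) (Ioc 0 b) ∧
      |h⁻¹ * (∫ t in Ioc 0 b, ∫ s in (0 : ℝ)..h,
          (Ioc 0 T).indicator g (s + t) ((Ioc 0 T).indicator v (σ + t)))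
        - ∫ t in Ioc 0 b, g t (v t)| ≤ ε := by
  obtain ⟨δ, hδ, H⟩ := exists_forall_average_translate_le (ContinuousLinearMap.id ℝ _)
    ((memLp_indicator_iff_restrict measurableSet_Ioc).2 hg)
    ((memLp_indicator_iff_restrict measurableSet_Ioc).2 hv) hε
  refine ⟨δ, hδ, fun h σ h0 h1 h2 b hb => ?_⟩
  obtain ⟨k1, k2⟩ := H h σ h0 h1 h2 (Ioc 0 b) measurableSet_Ioc
  refine ⟨k1, ?_⟩
  have e : ∫ t in Ioc 0 b, g t (v t) = ∫ t in Ioc 0 b,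
      (Ioc 0 T).indicator g t ((Ioc 0 T).indicator v t) := by
    refine setIntegral_congr_fun measurableSet_Ioc fun t ht => ?_
    have hm : t ∈ Ioc 0 T := ⟨ht.1, ht.2.trans hb⟩
    simp only [indicator_of_mem hm]
  rw [e]
  exact k2

/-- Integration by parts in a Gelfand triple `V → H → V*`. The difference quotients of
`t ↦ (c₁(t), c₂(t))` are Steklov averages of `⟨g₁, v₂⟩ + ⟨g₂, v₁⟩`, which converge in `L¹`. -/
theorem inner_sub_inner_eq_integral {j : V →L[ℝ] H} {T : ℝ} (hT : 0 < T)
    {v₁ v₂ : ℝ → V} {g₁ g₂ : ℝ → StrongDual ℝ V} {c₁ c₂ : ℝ → H}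
    (hv₁ : MemLp v₁ 2 (volume.restrict (Ioc 0 T))) (hv₂ : MemLp v₂ 2 (volume.restrict (Ioc 0 T)))
    (hg₁ : MemLp g₁ 2 (volume.restrict (Ioc 0 T))) (hg₂ : MemLp g₂ 2 (volume.restrict (Ioc 0 T)))
    (hc₁ : ContinuousOn c₁ (Icc 0 T)) (hc₂ : ContinuousOn c₂ (Icc 0 T))
    (hvc₁ : ∀ᵐ t ∂volume.restrict (Ioc 0 T), j (v₁ t) = c₁ t)
    (hvc₂ : ∀ᵐ t ∂volume.restrict (Ioc 0 T), j (v₂ t) = c₂ t)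
    (hp₁ : IsPrimitive j T c₁ g₁) (hp₂ : IsPrimitive j T c₂ g₂) :
    ⟪c₁ T, c₂ T⟫_ℝ - ⟪c₁ 0, c₂ 0⟫_ℝ = ∫ t in (0 : ℝ)..T, (g₁ t (v₂ t) + g₂ t (v₁ t)) := by
  obtain ⟨F, hF, hFI⟩ : ∃ F : ℝ → ℝ, Continuous F ∧ ∀ t ∈ Icc 0 T, F t = ⟪c₁ t, c₂ t⟫_ℝ := by
    refine ⟨IccExtend hT.le (fun t : Icc 0 T => ⟪c₁ t, c₂ t⟫_ℝ), ?_, fun t ht => ?_⟩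
    · exact (continuousOn_iff_continuous_domRestrict.1 (hc₁.inner hc₂)).Icc_extend'
    · rw [IccExtend_of_mem _ _ ht]
  have i1 := integrable_dual_apply hg₁ hv₂
  have i2 := integrable_dual_apply hg₂ hv₁
  have hψi := i1.add i2
  have lim1 := tendsto_inv_mul_integral_sub (T := T) hF
  have lim2 : Filter.Tendsto (fun h : ℝ => ∫ t in (0 : ℝ)..(T - h), (g₁ t (v₂ t) + g₂ t (v₁ t)))
      (nhdsWithin 0 (Ioi 0)) (nhds (∫ t in (0 : ℝ)..T, (g₁ t (v₂ t) + g₂ t (v₁ t)))) := by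
    have hc : ContinuousOn (fun x : ℝ => ∫ t in (0 : ℝ)..x, (g₁ t (v₂ t) + g₂ t (v₁ t)))
        (Icc 0 T) := by
      rw [← uIcc_of_le hT.le]
      refine intervalIntegral.continuousOn_primitive_interval' ?_ left_mem_uIcc
      rw [intervalIntegrable_iff_integrableOn_Ioc_of_le hT.le]
      exact hψi
    refine (hc T (right_mem_Icc.2 hT.le)).tendsto.comp
      (tendsto_nhdsWithin_iff.2 ⟨?_, ?_⟩)
    · have : Continuous fun h : ℝ => T - h := by fun_prop
      simpa using (this.tendsto 0).mono_left nhdsWithin_le_nhds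
    · filter_upwards [Ioo_mem_nhdsGT hT] with h hh
      exact ⟨by linarith [hh.2], by linarith [hh.1]⟩
  have lim3 : Filter.Tendsto (fun h : ℝ => h⁻¹ * (∫ t in (0 : ℝ)..(T - h), (F (t + h) - F t))
      - ∫ t in (0 : ℝ)..(T - h), (g₁ t (v₂ t) + g₂ t (v₁ t))) (nhdsWithin 0 (Ioi 0)) (nhds 0) := by
    rw [Metric.tendsto_nhds]
    intro ε hε
    obtain ⟨δ₁, hδ₁, H₁⟩ := exists_forall_average_dual_translate_le hg₁ hv₂
      (ε := ε / 3) (by linarith)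
    obtain ⟨δ₂, hδ₂, H₂⟩ := exists_forall_average_dual_translate_le hg₂ hv₁
      (ε := ε / 3) (by linarith)
    have hpos : 0 < min T (min δ₁ δ₂) := lt_min hT (lt_min hδ₁ hδ₂)
    filter_upwards [Ioo_mem_nhdsGT hpos] with h hh
    have h0 : 0 < h := hh.1
    have hhT : h < T := hh.2.trans_le (min_le_left _ _)
    have hh1 : h < δ₁ := hh.2.trans_le ((min_le_right _ _).trans (min_le_left _ _))
    have hh2 : h < δ₂ := hh.2.trans_le ((min_le_right _ _).trans (min_le_right _ _))
    -- In `F(t+h) - F(t) = (c₁(t+h) - c₁(t), c₂(t+h)) + (c₁(t), c₂(t+h) - c₂(t))`, the first average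
    -- is tested with `v₂(t+h)`, the second one with `v₁(t)`.
    obtain ⟨j1, e1⟩ := H₁ h h h0 hh1 (abs_of_pos h0).le (T - h) (by linarith)
    obtain ⟨j2, e2⟩ := H₂ h 0 h0 hh2 (by simpa using h0.le) (T - h) (by linarith)
    have key : ∫ t in (0 : ℝ)..(T - h), (F (t + h) - F t)
        = (∫ t in Ioc 0 (T - h), ∫ s in (0 : ℝ)..h,
            (Ioc 0 T).indicator g₁ (s + t) ((Ioc 0 T).indicator v₂ (h + t)))
          + ∫ t in Ioc 0 (T - h), ∫ s in (0 : ℝ)..h,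
            (Ioc 0 T).indicator g₂ (s + t) ((Ioc 0 T).indicator v₁ (0 + t)) := by
      refine Eq.trans ?_ (integral_add j1 j2)
      rw [intervalIntegral.integral_of_le (by linarith)]
      refine setIntegral_congr_ae measurableSet_Ioc ?_
      have a1 := (ae_restrict_iff' measurableSet_Ioc).1 hvc₁
      have a2 := (measurePreserving_add_left volume h).quasiMeasurePreserving.ae
        ((ae_restrict_iff' measurableSet_Ioc).1 hvc₂)
      filter_upwards [a1, a2] with t b1 b2 ht
      have m1 : t ∈ Ioc 0 T := ⟨ht.1, by linarith [ht.2]⟩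
      have m2 : h + t ∈ Ioc 0 T := ⟨by linarith [ht.1], by linarith [ht.2]⟩
      rw [hFI _ (Ioc_subset_Icc_self m1), hFI _ (by
        rw [add_comm]; exact Ioc_subset_Icc_self m2)]
      exact hp₁.inner_sub_inner_eq hp₂ h0 ht (b1 m1) (b2 m2)
    have hsub : Ioc 0 (T - h) ⊆ Ioc 0 T := Ioc_subset_Ioc_right (by linarith)
    have key2 : ∫ t in (0 : ℝ)..(T - h), (g₁ t (v₂ t) + g₂ t (v₁ t))
        = (∫ t in Ioc 0 (T - h), g₁ t (v₂ t)) + ∫ t in Ioc 0 (T - h), g₂ t (v₁ t) := by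
      rw [intervalIntegral.integral_of_le (by linarith)]
      exact integral_add (IntegrableOn.mono_set i1 hsub) (IntegrableOn.mono_set i2 hsub)
    rw [key, key2, Real.dist_eq, sub_zero, mul_add]
    rw [abs_le] at e1 e2
    rw [abs_lt]
    constructor <;> linarith [e1.1, e1.2, e2.1, e2.2]
  have huniq := tendsto_nhds_unique lim3 (lim1.sub lim2)
  rw [hFI T (right_mem_Icc.2 hT.le), hFI 0 (left_mem_Icc.2 hT.le)] at huniq
  linarith

end Gelfand

/-! ### The mean-value linearization -/

section MeanLin

variable {X Y : Type*} [NormedAddCommGroup X] [NormedSpace ℝ X]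
  [NormedAddCommGroup Y] [NormedSpace ℝ Y]

lemma continuous_gateaux_segment {F : X → StrongDual ℝ Y}
    (hc : ∀ (w : X) (v : Y), Continuous fun x => gateaux F x w v) (u uhat w : X) (v : Y) :
    Continuous fun s : ℝ => gateaux F (s • u + (1 - s) • uhat) w v :=
  (hc w v).comp (by fun_prop)

/-- The mean value theorem: `F^s(u, û; u - û, v) = F(u; v) - F(û; v)`. -/
lemma meanLin_sub_eq {F : X → StrongDual ℝ Y}
    (hd : ∀ (x w : X) (v : Y), LineDifferentiableAt ℝ (fun y => F y v) x w)
    (hc : ∀ (w : X) (v : Y), Continuous fun x => gateaux F x w v) (u uhat : X) (v : Y) :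
    meanLin F u uhat (u - uhat) v = F u v - F uhat v := by
  have hder : ∀ s : ℝ, HasDerivAt (fun s : ℝ => F (s • u + (1 - s) • uhat) v)
      (gateaux F (s • u + (1 - s) • uhat) (u - uhat) v) s := by
    intro s
    have h := (hd (s • u + (1 - s) • uhat) (u - uhat) v).hasLineDerivAt
    rw [HasLineDerivAt] at h
    have h' := HasDerivAt.comp_sub_const (x := s) (a := s) (by simpa using h)
    refine h'.congr_of_eventuallyEq (Filter.Eventually.of_forall fun r => ?_)
    have e : r • u + (1 - r) • uhat = s • u + (1 - s) • uhat + (r - s) • (u - uhat) := by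
      module
    simp only [e]
  rw [meanLin, intervalIntegral.integral_eq_sub_of_hasDerivAt (fun s _ => hder s)
    ((continuous_gateaux_segment hc u uhat _ v).intervalIntegrable _ _)]
  simp

/-- The mean-value linearization is a bounded linear functional of its direction; the bound is
uniform along the segment by the Banach–Steinhaus theorem. -/
lemma ContGateauxDiff.exists_meanLin_eq [CompleteSpace X] {F : X → StrongDual ℝ Y}
    (hF : ContGateauxDiff F) (u uhat : X) (v : Y) :
    ∃ L : StrongDual ℝ X, ∀ w, meanLin F u uhat w v = L w := by
  choose D hD using hF.bounded_bilinear
  have hcont := fun w => continuous_gateaux_segment hF.continuous u uhat w v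
  have hint := fun w => (hcont w).intervalIntegrable (μ := volume) 0 1
  obtain ⟨C, hC⟩ := banach_steinhaus
    (g := fun s : Icc (0 : ℝ) 1 => (D ((s : ℝ) • u + (1 - (s : ℝ)) • uhat)).flip v) (by
      intro w
      obtain ⟨C, hC⟩ := isCompact_Icc.exists_bound_of_continuousOn
        (hcont w).continuousOn (s := Icc (0 : ℝ) 1)
      refine ⟨C, fun s => ?_⟩
      rw [ContinuousLinearMap.flip_apply, ← hD]
      exact hC s s.2)
  let l : X →ₗ[ℝ] ℝ :=
    { toFun := fun w => meanLin F u uhat w v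
      map_add' := fun w w' => by
        rw [meanLin, meanLin, meanLin, ← intervalIntegral.integral_add (hint w) (hint w')]
        simp only [hD, map_add, add_apply]
      map_smul' := fun c w => by
        rw [meanLin, meanLin, RingHom.id_apply, smul_eq_mul,
          ← intervalIntegral.integral_const_mul]
        simp only [hD, map_smul, smul_apply, smul_eq_mul] }
  refine ⟨l.mkContinuous C fun w => ?_, fun w => rfl⟩
  have := intervalIntegral.norm_integral_le_of_norm_le_const (a := 0) (b := 1)
    (C := C * ‖w‖) (f := fun s : ℝ => gateaux F (s • u + (1 - s) • uhat) w v) (by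
      intro s hs
      rw [uIoc_of_le zero_le_one] at hs
      rw [hD]
      exact ContinuousLinearMap.le_of_opNorm_le _ (hC ⟨s, Ioc_subset_Icc_self hs⟩) w)
  rw [sub_zero, abs_one, mul_one] at this
  exact this

end MeanLin

namespace Problem

variable {d : ℕ} {Ω : Set (EuclideanSpace ℝ (Fin d))} {V : Type*}
  [NormedAddCommGroup V] [InnerProductSpace ℝ V] (P : Problem Ω V)

lemma hasLineDerivAt_Nl (x w v : V) :
    HasLineDerivAt ℝ (fun y => P.Nl y v)
      (gateaux P.Nc x w v - gateaux P.Ne (P.emb x) (P.emb w) (P.emb v)) x w := by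
  have h1 := (P.Nc_smooth.differentiable x w v).hasLineDerivAt
  have h2 := (P.Ne_smooth.differentiable (P.emb x) (P.emb w) (P.emb v)).hasLineDerivAt
  rw [HasLineDerivAt] at h1 h2 ⊢
  simpa [Nl, gateaux] using h1.fun_sub h2

lemma meanLin_Nl_sub_eq (u uhat v : V) :
    meanLin P.Nl u uhat (u - uhat) v = P.Nl u v - P.Nl uhat v := by
  refine meanLin_sub_eq (fun x w v => (P.hasLineDerivAt_Nl x w v).lineDifferentiableAt)
    (fun w v => ?_) u uhat v
  have : (fun x => gateaux P.Nl x w v)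
      = fun x => gateaux P.Nc x w v - gateaux P.Ne (P.emb x) (P.emb w) (P.emb v) :=
    funext fun x => (P.hasLineDerivAt_Nl x w v).lineDeriv
  rw [this]
  exact (P.Nc_smooth.continuous w v).sub
    ((P.Ne_smooth.continuous (P.emb w) (P.emb v)).comp P.emb.continuous)

end Problem

/-! ### Piecewise linear interpolation in time -/

namespace TimeGrid

variable {T : ℝ} (G : TimeGrid T)

lemma N_pos (hT : 0 < T) : 0 < G.N := by
  rcases Nat.eq_zero_or_pos G.N with h | h
  · have h1 := G.node_zero
    have h2 := G.node_last
    rw [h] at h2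
    linarith
  · exact h

lemma node_lt_node {i j : ℕ} (hij : i < j) (hj : j ≤ G.N) : G.node i < G.node j := by
  induction j, hij using Nat.le_induction with
  | base => exact G.node_lt i hj
  | succ j _ ih => exact (ih (by omega)).trans (G.node_lt j hj)

lemma node_le_node {i j : ℕ} (hij : i ≤ j) (hj : j ≤ G.N) : G.node i ≤ G.node j := by
  rcases hij.eq_or_lt with rfl | h
  · exact le_rfl
  · exact (G.node_lt_node h hj).le

lemma node_nonneg {k : ℕ} (hk : k ≤ G.N) : 0 ≤ G.node k := by
  rw [← G.node_zero]
  exact G.node_le_node (Nat.zero_le k) hk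

lemma node_le_T {k : ℕ} (hk : k ≤ G.N) : G.node k ≤ T := by
  have h := G.node_le_node hk le_rfl
  rwa [G.node_last] at h

lemma tau_succ (k : ℕ) : G.tau (k + 1) = G.node (k + 1) - G.node k := rfl

lemma tau_succ_pos {k : ℕ} (hk : k < G.N) : 0 < G.tau (k + 1) :=
  sub_pos.2 (G.node_lt k hk)

lemma hat_left {k : ℕ} (hk : k < G.N) {t : ℝ} (ht : t ∈ Icc (G.node k) (G.node (k + 1))) :
    G.hat k t = (G.node (k + 1) - t) / G.tau (k + 1) := by
  rw [hat, if_pos ⟨hk, ht⟩]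

lemma hat_right {k : ℕ} (hk : k < G.N) {t : ℝ} (ht : t ∈ Icc (G.node k) (G.node (k + 1))) :
    G.hat (k + 1) t = (t - G.node k) / G.tau (k + 1) := by
  rw [hat]
  split_ifs with h1 h2
  · have e : t = G.node (k + 1) := le_antisymm ht.2 h1.2.1
    rw [e, ← G.tau_succ, ← G.tau_succ, div_self (G.tau_succ_pos h1.1).ne',
      div_self (G.tau_succ_pos hk).ne']
  · rfl
  · exact absurd ⟨Nat.le_add_left 1 k, ht⟩ h2

lemma hat_eq_zero {k i : ℕ} (hk : k < G.N) (hi : i ≤ G.N) (h1 : i ≠ k) (h2 : i ≠ k + 1) {t : ℝ}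
    (ht : t ∈ Icc (G.node k) (G.node (k + 1))) : G.hat i t = 0 := by
  rw [hat]
  split_ifs with h h'
  · rcases lt_or_gt_of_ne h1 with hlt | hgt
    · have e : t = G.node (i + 1) :=
        le_antisymm h.2.2 ((G.node_le_node hlt hk.le).trans ht.1)
      rw [e, sub_self, zero_div]
    · have := G.node_lt_node (show k + 1 < i by omega) hi
      linarith [h.2.1, ht.2]
  · obtain ⟨i, rfl⟩ := Nat.exists_eq_add_of_le' h'.1
    simp only [Nat.add_sub_cancel] at h' ⊢
    rcases lt_or_gt_of_ne h1 with hlt | hgt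
    · have := G.node_lt_node hlt hk.le
      linarith [h'.2.2, ht.1]
    · have e : t = G.node i :=
        le_antisymm (ht.2.trans (G.node_le_node (by omega) (by omega))) h'.2.1
      rw [e, sub_self, zero_div]
  · rfl

lemma exists_mem_Ioc {t : ℝ} (ht : t ∈ Ioc 0 T) :
    ∃ k < G.N, t ∈ Ioc (G.node k) (G.node (k + 1)) := by
  have key : ∀ n ≤ G.N, t ≤ G.node n → ∃ k < G.N, t ∈ Ioc (G.node k) (G.node (k + 1)) := by
    intro n
    induction n with
    | zero =>
      intro _ h
      rw [G.node_zero] at h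
      linarith [ht.1]
    | succ n ih =>
      intro hn h
      rcases le_or_gt t (G.node n) with h' | h'
      · exact ih (by omega) h'
      · exact ⟨n, hn, h', h⟩
  exact key G.N le_rfl (by rw [G.node_last]; exact ht.2)

lemma measurable_hat (k : ℕ) : Measurable (G.hat k) := by
  unfold hat
  refine Measurable.ite ?_ (by fun_prop) (Measurable.ite ?_ (by fun_prop) measurable_const)
  · exact (MeasurableSet.const _).inter measurableSet_Icc
  · exact (MeasurableSet.const _).inter measurableSet_Icc

lemma norm_hat_le_one {k : ℕ} (hk : k ≤ G.N) {t : ℝ} (ht : t ∈ Ioc 0 T) : ‖G.hat k t‖ ≤ 1 := by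
  obtain ⟨i, hi, hti⟩ := G.exists_mem_Ioc ht
  have hti' := Ioc_subset_Icc_self hti
  have hτ := G.tau_succ_pos hi
  have hτ' := G.tau_succ i
  by_cases h1 : k = i
  · rw [h1, G.hat_left hi hti', Real.norm_of_nonneg (div_nonneg (by linarith [hti.2]) hτ.le),
      div_le_one hτ]
    linarith [hti.1]
  by_cases h2 : k = i + 1
  · rw [h2, G.hat_right hi hti', Real.norm_of_nonneg (div_nonneg (by linarith [hti.1]) hτ.le),
      div_le_one hτ]
    linarith [hti.2]
  · rw [G.hat_eq_zero hi hk h1 h2 hti']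
    simp

section Interp

variable {X : Type*} [NormedAddCommGroup X] [NormedSpace ℝ X] (w : ℕ → X)

lemma interp_eq {k : ℕ} (hk : k < G.N) {t : ℝ} (ht : t ∈ Icc (G.node k) (G.node (k + 1))) :
    G.interp w t = w k + (t - G.node k) • (G.tau (k + 1))⁻¹ • (w (k + 1) - w k) := by
  have e : G.interp w t = G.hat k t • w k + G.hat (k + 1) t • w (k + 1) := by
    rw [interp]
    refine Finset.sum_eq_add_of_mem k (k + 1) (by simp; omega) (by simp; omega) (by omega) ?_
    intro i hi h
    rw [G.hat_eq_zero hk (by simpa [Nat.lt_succ_iff] using hi) h.1 h.2 ht, zero_smul]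
  rw [e, G.hat_left hk ht, G.hat_right hk ht]
  have hτ := (G.tau_succ_pos hk).ne'
  have h1 : (G.node (k + 1) - t) / G.tau (k + 1) = 1 - (t - G.node k) * (G.tau (k + 1))⁻¹ := by
    rw [← mul_inv_cancel₀ hτ, ← sub_mul, ← div_eq_mul_inv, G.tau_succ]
    ring
  rw [h1, div_eq_mul_inv]
  module

lemma interp_zero (hT : 0 < T) : G.interp w 0 = w 0 := by
  have hN := G.N_pos hT
  have h := G.node_lt 0 hN
  rw [G.node_zero] at h
  rw [G.interp_eq w hN ⟨G.node_zero.le, h.le⟩, G.node_zero, sub_zero, zero_smul, add_zero]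

lemma interp_last (hT : 0 < T) : G.interp w T = w G.N := by
  obtain ⟨n, hn⟩ := Nat.exists_eq_succ_of_ne_zero (G.N_pos hT).ne'
  have hlt : n < G.N := by omega
  have h : G.interp w (G.node (n + 1)) = w (n + 1) := by
    rw [G.interp_eq w hlt (right_mem_Icc.2 (G.node_lt n hlt).le), ← G.tau_succ,
      smul_smul, mul_inv_cancel₀ (G.tau_succ_pos hlt).ne', one_smul]
    abel
  rwa [← Nat.succ_eq_add_one, ← hn, G.node_last] at h

lemma hasDerivAt_interp {k : ℕ} (hk : k < G.N) {t : ℝ}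
    (ht : t ∈ Ioo (G.node k) (G.node (k + 1))) :
    HasDerivAt (G.interp w) ((G.tau (k + 1))⁻¹ • (w (k + 1) - w k)) t := by
  have h : HasDerivAt (fun t => w k + (t - G.node k) • (G.tau (k + 1))⁻¹ • (w (k + 1) - w k))
      ((1 : ℝ) • (G.tau (k + 1))⁻¹ • (w (k + 1) - w k)) t :=
    (((hasDerivAt_id t).sub_const _).smul_const _).const_add _
  rw [one_smul] at h
  refine h.congr_of_eventuallyEq ?_
  filter_upwards [Ioo_mem_nhds ht.1 ht.2] with s hs
  exact G.interp_eq w hk (Ioo_subset_Icc_self hs)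

lemma continuousOn_interp : ContinuousOn (G.interp w) (Icc 0 T) := by
  have key : ∀ n ≤ G.N, ContinuousOn (G.interp w) (Icc 0 (G.node n)) := by
    intro n
    induction n with
    | zero =>
      intro _
      rw [G.node_zero, Icc_self]
      exact continuousOn_singleton _ _
    | succ n ih =>
      intro hn
      rw [← Icc_union_Icc_eq_Icc (G.node_nonneg (Nat.le_of_succ_le hn)) (G.node_lt n hn).le]
      refine (ih (by omega)).union_of_isClosed ?_ isClosed_Icc isClosed_Icc
      have h : ContinuousOn
          (fun t => w n + (t - G.node n) • (G.tau (n + 1))⁻¹ • (w (n + 1) - w n))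
          (Icc (G.node n) (G.node (n + 1))) := by fun_prop
      exact h.congr fun t ht => G.interp_eq w hn ht
  have := key G.N le_rfl
  rwa [G.node_last] at this

lemma memLp_interp {p : ENNReal} : MemLp (G.interp w) p (volume.restrict (Ioc 0 T)) := by
  unfold interp
  refine memLp_finsetSum _ fun k hk => ?_
  refine MemLp.of_bound ((G.measurable_hat k).aestronglyMeasurable.smul_const _) ‖w k‖ ?_
  rw [ae_restrict_iff' measurableSet_Ioc]
  refine Filter.Eventually.of_forall fun t ht => ?_
  rw [norm_smul]
  exact mul_le_of_le_one_left (norm_nonneg _)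
    (G.norm_hat_le_one (by simpa [Nat.lt_succ_iff] using hk) ht)

/-- The derivative of `G.interp w`, as a step function. -/
def slope (t : ℝ) : X :=
  ∑ k ∈ Finset.range G.N, (Ioc (G.node k) (G.node (k + 1))).indicator
    (fun _ => (G.tau (k + 1))⁻¹ • (w (k + 1) - w k)) t

lemma slope_eq {k : ℕ} (hk : k < G.N) {t : ℝ} (ht : t ∈ Ioc (G.node k) (G.node (k + 1))) :
    G.slope w t = (G.tau (k + 1))⁻¹ • (w (k + 1) - w k) := by
  rw [slope, Finset.sum_eq_single_of_mem k (Finset.mem_range.2 hk), indicator_of_mem ht]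
  intro i hi hik
  refine indicator_of_notMem (fun h => ?_) _
  rcases lt_or_gt_of_ne hik with hlt | hgt
  · exact absurd (h.2.trans (G.node_le_node hlt hk.le)) (not_le.2 ht.1)
  · exact absurd (ht.2.trans (G.node_le_node hgt (Finset.mem_range.1 hi).le)) (not_le.2 h.1)

lemma memLp_slope {p : ENNReal} : MemLp (G.slope w) p (volume.restrict (Ioc 0 T)) := by
  unfold slope
  exact memLp_finsetSum _ fun k _ => (memLp_const _).indicator measurableSet_Ioc

lemma hasDerivAt_interp_of_notMem {t : ℝ} (ht : t ∈ Ioc 0 T) (hn : t ∉ range G.node) :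
    HasDerivAt (G.interp w) (G.slope w t) t := by
  obtain ⟨k, hk, htk⟩ := G.exists_mem_Ioc ht
  rw [G.slope_eq w hk htk]
  exact G.hasDerivAt_interp w hk ⟨htk.1, lt_of_le_of_ne htk.2 fun h => hn ⟨k + 1, h.symm⟩⟩

lemma deriv_interp_ae_eq :
    ∀ᵐ t ∂volume.restrict (Ioc 0 T), deriv (G.interp w) t = G.slope w t := by
  rw [ae_restrict_iff' measurableSet_Ioc]
  filter_upwards [(countable_range G.node).ae_notMem volume] with t hn ht
  exact (G.hasDerivAt_interp_of_notMem w ht hn).deriv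

end Interp

/-- An integral over `(0, T)` is the sum of the integrals over the time steps. -/
lemma sum_integral_eq {f : ℝ → ℝ} (hT : 0 < T) (hf : IntervalIntegrable f volume 0 T) :
    ∑ k ∈ Finset.range G.N, ∫ t in (G.node k)..(G.node (k + 1)), f t = ∫ t in (0 : ℝ)..T, f t := by
  rw [intervalIntegral.sum_integral_adjacent_intervals, G.node_zero, G.node_last]
  intro k hk
  refine hf.mono_set ?_
  rw [uIcc_of_le (G.node_lt k hk).le, uIcc_of_le hT.le]
  exact Icc_subset_Icc (G.node_nonneg hk.le) (G.node_le_T hk)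

end TimeGrid

namespace Problem

variable {d : ℕ} {Ω : Set (EuclideanSpace ℝ (Fin d))} {V : Type*}
  [NormedAddCommGroup V] [InnerProductSpace ℝ V] (P : Problem Ω V) (G : TimeGrid P.T)

/-! ### The spatial error -/

lemma levels_zero (a : L2 Ω) (u : ℕ → V) : P.levels a u 0 = a := rfl

lemma levels_succ (a : L2 Ω) (u : ℕ → V) (k : ℕ) :
    P.levels a u (k + 1) = P.emb (u (k + 1)) := rfl

lemma integrable_hat_smul_q {k : ℕ} (hk : k ≤ G.N) :
    Integrable (fun t => G.hat k t • P.q t) (volume.restrict (Ioc 0 P.T)) := by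
  refine (P.q_mem.integrable (by norm_num)).bdd_smul (φ := G.hat k) 1
    (G.measurable_hat k).aestronglyMeasurable ?_
  rw [ae_restrict_iff' measurableSet_Ioc]
  exact Filter.Eventually.of_forall fun t ht => G.norm_hat_le_one hk ht

lemma tau_smul_qk {k : ℕ} (hk : k ≤ G.N) :
    G.tau (max k 1) • P.qk G k = ∫ t in (0 : ℝ)..P.T, G.hat k t • P.q t := by
  have h : G.tau (max k 1) ≠ 0 := by
    obtain ⟨m, hm⟩ := Nat.exists_eq_add_of_le' (le_max_right k 1)
    rw [hm]
    have hN := G.N_pos P.T_pos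
    exact (G.tau_succ_pos (by omega)).ne'
  rw [qk, smul_inv_smul₀ h]

/-- The weights `q_k` are chosen so that the goal functional of an interpolant is a finite sum. -/
lemma Q_interp (w : ℕ → L2 Ω) :
    P.Q (G.interp w) = ⟪P.qbar, w G.N⟫_ℝ
      + ∑ k ∈ Finset.range (G.N + 1), G.tau (max k 1) * ⟪P.qk G k, w k⟫_ℝ := by
  have h1 : ∀ t, ⟪P.q t, G.interp w t⟫_ℝ
      = ∑ k ∈ Finset.range (G.N + 1), ⟪w k, G.hat k t • P.q t⟫_ℝ := by
    intro t
    rw [TimeGrid.interp, inner_sum]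
    refine Finset.sum_congr rfl fun k _ => ?_
    rw [real_inner_smul_right, real_inner_smul_right, real_inner_comm]
  have hint : ∀ k ∈ Finset.range (G.N + 1),
      Integrable (fun t => G.hat k t • P.q t) (volume.restrict (Ioc 0 P.T)) := fun k hk =>
    P.integrable_hat_smul_q G (by simpa [Nat.lt_succ_iff] using hk)
  rw [Q, G.interp_last w P.T_pos]
  congr 1
  simp only [h1]
  rw [intervalIntegral.integral_of_le P.T_pos.le,
    integral_finsetSum _ fun k hk => (hint k hk).const_inner (w k)]
  refine Finset.sum_congr rfl fun k hk => ?_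
  rw [integral_inner (hint k hk), ← intervalIntegral.integral_of_le P.T_pos.le,
    ← P.tau_smul_qk G (by simpa [Nat.lt_succ_iff] using hk), real_inner_smul_right,
    real_inner_comm]

lemma emb_interp (w : ℕ → V) (t : ℝ) :
    P.emb (G.interp w t) = G.interp (fun k => P.emb (w k)) t := by
  simp only [TimeGrid.interp, map_sum, map_smul]

variable {P G} {fk : ℕ → StrongDual ℝ V} {a : L2 Ω} {u uh z : ℕ → V}

/-- The spatial residual in terms of the difference of the two discrete solutions. -/
lemma IsTimeDiscreteSolution.tau_mul_resH (hu : P.IsTimeDiscreteSolution G fk a u) {k : ℕ}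
    (hk : k < G.N) (v : V) :
    G.tau (k + 1) * P.resH G fk uh k v
      = ⟪P.levels a u (k + 1) - P.emb (uh (k + 1)), P.emb v⟫_ℝ
        - ⟪P.levels a u k - P.emb (uh k), P.emb v⟫_ℝ
        + G.tau (k + 1) * (P.B v (u (k + 1) - uh (k + 1))
          + (P.Nc (u (k + 1)) v - P.Nc (uh (k + 1)) v)
          - (P.Ne (P.levels a u k) (P.emb v) - P.Ne (P.emb (uh k)) (P.emb v))) := by
  have hτ := (G.tau_succ_pos hk).ne'
  rw [resH, ← hu.2 k hk v, map_smul, map_sub, real_inner_smul_left, real_inner_smul_left,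
    map_sub, P.B_symm v, P.B_symm v]
  simp only [inner_sub_left]
  field_simp
  ring

/-- The first equation of the discrete dual problem, tested with an arbitrary element of `L²(Ω)`
in place of one of `V`: the initial error does not belong to `V`. -/
lemma IsTimeDiscreteDualSolution.initial_eq (hz : P.IsTimeDiscreteDualSolution G a u uh z)
    (w : L2 Ω) :
    -⟪P.emb ((G.tau 1)⁻¹ • (z 1 - z 0)), w⟫_ℝ - meanLin P.Ne a (P.emb (uh 0)) w (P.emb (z 1))
      = ⟪P.qk G 0, w⟫_ℝ := by
  obtain ⟨L, hL⟩ := P.Ne_smooth.exists_meanLin_eq a (P.emb (uh 0)) (P.emb (z 1))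
  have h := P.emb_dense.equalizer
    (g := fun w => -⟪P.emb ((G.tau 1)⁻¹ • (z 1 - z 0)), w⟫_ℝ - L w)
    (h := fun w => ⟪P.qk G 0, w⟫_ℝ) (by fun_prop) (by fun_prop) (by
      ext w
      simp only [Function.comp_apply, ← hL]
      exact hz.1 w)
  rw [hL]
  exact congrFun h w

/-- The first equation of the discrete dual problem, tested with the initial error. -/
lemma IsTimeDiscreteDualSolution.zero_eq (hz : P.IsTimeDiscreteDualSolution G a u uh z) :
    G.tau 1 * ⟪P.qk G 0, a - P.emb (uh 0)⟫_ℝ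
      = ⟪a - P.emb (uh 0), P.emb (z 0)⟫_ℝ - ⟪a - P.emb (uh 0), P.emb (z 1)⟫_ℝ
        - G.tau 1 * (P.Ne a (P.emb (z 1)) - P.Ne (P.emb (uh 0)) (P.emb (z 1))) := by
  have hτ : G.tau 1 ≠ 0 := (G.tau_succ_pos (G.N_pos P.T_pos)).ne'
  rw [← hz.initial_eq, meanLin_sub_eq P.Ne_smooth.differentiable P.Ne_smooth.continuous,
    map_smul, map_sub, real_inner_smul_left, inner_sub_left, real_inner_comm,
    real_inner_comm _ (P.emb (z 0))]
  field_simp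
  ring

/-- The inner equations of the discrete dual problem, tested with the error. -/
lemma IsTimeDiscreteDualSolution.succ_eq (hz : P.IsTimeDiscreteDualSolution G a u uh z) {k : ℕ}
    (hk : k + 1 < G.N) :
    G.tau (k + 1) * ⟪P.qk G (k + 1), P.emb (u (k + 1)) - P.emb (uh (k + 1))⟫_ℝ
      = ⟪P.emb (u (k + 1)) - P.emb (uh (k + 1)), P.emb (z (k + 1))⟫_ℝ
        - ⟪P.emb (u (k + 1)) - P.emb (uh (k + 1)), P.emb (z (k + 2))⟫_ℝ
        + G.tau (k + 1) * (P.B (z (k + 1)) (u (k + 1) - uh (k + 1))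
          + (P.Nc (u (k + 1)) (z (k + 1)) - P.Nc (uh (k + 1)) (z (k + 1))))
        - G.tau (k + 2) * (P.Ne (P.emb (u (k + 1))) (P.emb (z (k + 2)))
          - P.Ne (P.emb (uh (k + 1))) (P.emb (z (k + 2)))) := by
  have hτ := (G.tau_succ_pos (Nat.lt_of_succ_lt hk)).ne'
  rw [← map_sub P.emb (u (k + 1)), ← hz.2.1 (k + 1) (Nat.le_add_left 1 k) hk,
    meanLin_sub_eq P.Nc_smooth.differentiable P.Nc_smooth.continuous, map_sub P.emb (u (k + 1)),
    meanLin_sub_eq P.Ne_smooth.differentiable P.Ne_smooth.continuous,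
    map_smul, map_sub P.emb (z (k + 1 + 1)), real_inner_smul_left, inner_sub_left,
    real_inner_comm, real_inner_comm _ (P.emb (z (k + 1)))]
  field_simp
  ring

/-- The terminal equation of the discrete dual problem, tested with the error. -/
lemma IsTimeDiscreteDualSolution.last_eq (hz : P.IsTimeDiscreteDualSolution G a u uh z) {n : ℕ}
    (hn : n + 1 = G.N) :
    G.tau (n + 1) * ⟪P.qk G (n + 1), P.emb (u (n + 1)) - P.emb (uh (n + 1))⟫_ℝ
        + ⟪P.qbar, P.emb (u (n + 1)) - P.emb (uh (n + 1))⟫_ℝ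
      = ⟪P.emb (u (n + 1)) - P.emb (uh (n + 1)), P.emb (z (n + 1))⟫_ℝ
        + G.tau (n + 1) * (P.B (z (n + 1)) (u (n + 1) - uh (n + 1))
          + (P.Nc (u (n + 1)) (z (n + 1)) - P.Nc (uh (n + 1)) (z (n + 1)))) := by
  have h := hz.2.2 (u (n + 1) - uh (n + 1))
  rw [← hn, meanLin_sub_eq P.Nc_smooth.differentiable P.Nc_smooth.continuous,
    map_sub P.emb (u (n + 1))] at h
  rw [← h, real_inner_comm]
  ring

/-- The spatial error representation without the Galerkin term: the discrete dual equations,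
tested with the error, are summed by parts in time. -/
theorem Q_interp_sub_Q_interp_eq (hu : P.IsTimeDiscreteSolution G fk a u)
    (hz : P.IsTimeDiscreteDualSolution G a u uh z) :
    P.Q (G.interp (P.levels a u)) - P.Q (fun t => P.emb (G.interp uh t))
      = P.spatialRep G fk uh z := by
  have ha : a = P.u0 := ext_inner_right ℝ hu.1
  obtain ⟨n, hn⟩ := Nat.exists_eq_add_of_lt (G.N_pos P.T_pos)
  rw [zero_add] at hn
  simp only [P.emb_interp G]
  rw [P.Q_interp, P.Q_interp, spatialRep, ← ha]
  -- The partial sums, where the last bracket is what the terminal equation provides at `m + 1 = N`.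
  have key : ∀ m, m < G.N →
      ∑ k ∈ Finset.range (m + 1),
          G.tau (max k 1) * ⟪P.qk G k, P.levels a u k - P.emb (uh k)⟫_ℝ
        + (⟪P.emb (u (m + 1)) - P.emb (uh (m + 1)), P.emb (z (m + 1))⟫_ℝ
        + G.tau (m + 1) * (P.B (z (m + 1)) (u (m + 1) - uh (m + 1))
          + (P.Nc (u (m + 1)) (z (m + 1)) - P.Nc (uh (m + 1)) (z (m + 1)))))
      = ⟪a - P.emb (uh 0), P.emb (z 0)⟫_ℝ
        + ∑ k ∈ Finset.range (m + 1), G.tau (k + 1) * P.resH G fk uh k (z (k + 1)) := by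
    intro m
    induction m with
    | zero =>
      intro hm
      rw [Finset.sum_range_one, Finset.sum_range_one, hu.tau_mul_resH hm]
      simp only [levels_zero, levels_succ, zero_add, Nat.max_eq_right (Nat.zero_le 1)]
      rw [hz.zero_eq]
      ring
    | succ m ih =>
      intro hm
      have ih' := ih (by omega)
      rw [Finset.sum_range_succ, Finset.sum_range_succ _ (m + 1), hu.tau_mul_resH hm]
      simp only [levels_succ, Nat.max_eq_left (Nat.le_add_left 1 m)]
      rw [hz.succ_eq hm]
      linear_combination ih'
  have hlast := hz.last_eq hn.symm
  have hk := key n (by omega)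
  rw [hn, ← hk, Finset.sum_range_succ _ (n + 1), Finset.sum_range_succ _ (n + 1),
    Nat.max_eq_left (Nat.le_add_left 1 n)]
  simp only [inner_sub_right, mul_sub, Finset.sum_sub_distrib] at hlast ⊢
  simp only [levels_succ]
  linear_combination hlast

variable (P G) in
lemma resH_sub (k : ℕ) (v w : V) :
    P.resH G fk uh k (v - w) = P.resH G fk uh k v - P.resH G fk uh k w := by
  simp only [resH, map_sub, inner_sub_right]
  ring

/-- Galerkin orthogonality. -/
lemma IsFullyDiscreteSolution.spatialRep_sub {S : ℕ → Submodule ℝ V}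
    (h : P.IsFullyDiscreteSolution G fk S uh) {vh : ℕ → V} (hv : ∀ k ≤ G.N, vh k ∈ S k) :
    P.spatialRep G fk uh (fun k => z k - vh k) = P.spatialRep G fk uh z := by
  have h0 : ⟪P.u0 - P.emb (uh 0), P.emb (vh 0)⟫_ℝ = 0 := by
    rw [inner_sub_left, h.2.1 _ (hv 0 (Nat.zero_le _)), sub_self]
  have hr : ∀ k ∈ Finset.range G.N, P.resH G fk uh k (vh (k + 1)) = 0 := fun k hk => by
    have hk' := Finset.mem_range.1 hk
    rw [resH, ← h.2.2 k hk' _ (hv (k + 1) hk')]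
    ring
  rw [spatialRep, spatialRep, map_sub, inner_sub_right, h0, sub_zero]
  congr 1
  refine Finset.sum_congr rfl fun k hk => ?_
  rw [resH_sub, hr k hk, sub_zero]

end Problem

namespace Problem

variable {d : ℕ} {Ω : Set (EuclideanSpace ℝ (Fin d))} {V : Type*}
  [NormedAddCommGroup V] [InnerProductSpace ℝ V] {P : Problem Ω V} {G : TimeGrid P.T}

/-! ### The temporal error -/

lemma intervalIntegrable_of_integrable {f : ℝ → ℝ}
    (hf : Integrable f (volume.restrict (Ioc 0 P.T))) : IntervalIntegrable f volume 0 P.T := by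
  rw [intervalIntegrable_iff_integrableOn_Ioc_of_le P.T_pos.le]
  exact hf

lemma HasValue.isContRep_contRep {v : ℝ → V} {s : ℝ} {a : L2 Ω} (h : P.HasValue v s a) :
    P.IsContRep v (P.contRep v) := by
  obtain ⟨c, hc, _⟩ := h
  have hex : ∃ c, P.IsContRep v c := ⟨c, hc⟩
  rw [contRep, dif_pos hex]
  exact hex.choose_spec

/-- The continuous representative is unique on `[0, T]`. -/
lemma HasValue.contRep_eq {v : ℝ → V} {s : ℝ} {a : L2 Ω} (h : P.HasValue v s a)
    (hs : s ∈ Icc 0 P.T) : P.contRep v s = a := by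
  have h1 := h.isContRep_contRep
  obtain ⟨c, hc, rfl⟩ := h
  refine Measure.eqOn_Icc_of_ae_eq volume P.T_pos.ne ?_ h1.1 hc.1 hs
  rw [← restrict_Ioc_eq_restrict_Icc]
  filter_upwards [h1.2, hc.2] with t e1 e2
  rw [← e1, e2]

/-- The weak time derivative, tested with a fixed `w`, is the derivative of the scalar function
`(c, w)` in the sense of distributions, hence in the integrated sense. -/
lemma IsContRep.isPrimitive {v : ℝ → V} {c : ℝ → L2 Ω} {g : ℝ → StrongDual ℝ V}
    (hc : P.IsContRep v c) (hg : P.MemL2 g) (hv : P.IsWeakTimeDeriv v g) :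
    IsPrimitive P.emb P.T c g := by
  intro a ha b hb w
  have hgw : IntervalIntegrable (fun t => g t w) volume 0 P.T :=
    intervalIntegrable_of_integrable (integrable_dual_apply hg (memLp_const w))
  rw [inner_sub_left]
  refine sub_eq_integral_of_weakDeriv P.T_pos (F := fun t => ⟪c t, P.emb w⟫_ℝ)
    (hc.1.inner continuousOn_const) hgw ?_ a ha b hb
  intro φ h1 h2 h3
  rw [← hv φ h1 h2 h3 w, intervalIntegral.integral_of_le P.T_pos.le,
    intervalIntegral.integral_of_le P.T_pos.le]
  refine integral_congr_ae ?_
  filter_upwards [hc.2] with t ht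
  rw [ht]

variable (P) in
/-- The embedding `V → L²(Ω) → V*`. -/
def dualEmb : V →L[ℝ] StrongDual ℝ V :=
  (innerSL ℝ : L2 Ω →L[ℝ] L2 Ω →L[ℝ] ℝ).bilinearComp P.emb P.emb

lemma dualEmb_apply (v w : V) : P.dualEmb v w = ⟪P.emb v, P.emb w⟫_ℝ := rfl

lemma memLp_dualEmb_slope (w : ℕ → V) : P.MemL2 (fun t => P.dualEmb (G.slope w t)) :=
  P.dualEmb.comp_memLp' (G.memLp_slope w)

/-- The interpolant is piecewise linear, and the fundamental theorem of calculus tolerates the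
countable set of nodes. -/
lemma isPrimitive_interp (w : ℕ → V) :
    IsPrimitive P.emb P.T (fun t => P.emb (G.interp w t)) (fun t => P.dualEmb (G.slope w t)) := by
  intro a ha b hb v
  have hsub : uIcc a b ⊆ Icc 0 P.T := uIcc_subset_Icc ha hb
  rw [inner_sub_left]
  symm
  have hd : IntervalIntegrable (fun t => P.dualEmb (G.slope w t) v) volume 0 P.T :=
    intervalIntegrable_of_integrable (integrable_dual_apply (memLp_dualEmb_slope w) (memLp_const v))
  refine MeasureTheory.integral_eq_of_hasDerivAt_off_countable
    (fun t => P.dualEmb.flip v (G.interp w t)) _ (countable_range G.node) ?_ ?_ ?_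
  · exact (P.dualEmb.flip v).continuous.comp_continuousOn ((G.continuousOn_interp w).mono hsub)
  · intro t ht
    have ht' : t ∈ Ioc 0 P.T :=
      ⟨(le_min ha.1 hb.1).trans_lt ht.1.1, (ht.1.2.trans_le (max_le ha.2 hb.2)).le⟩
    exact (P.dualEmb.flip v).hasFDerivAt.comp_hasDerivAt t
      (G.hasDerivAt_interp_of_notMem w ht' ht.2)
  · refine hd.mono_set ?_
    rwa [uIcc_of_le P.T_pos.le]

lemma integrable_B {v w : ℝ → V} (hv : P.MemL2 v) (hw : P.MemL2 w) :
    IntervalIntegrable (fun t => P.B (v t) (w t)) volume 0 P.T :=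
  intervalIntegrable_of_integrable
    (integrable_dual_apply (g := fun t => P.B (v t)) (P.B.comp_memLp' hv) hw)

lemma integrable_inner_q {w : ℝ → L2 Ω} (hw : P.MemL2 w) :
    IntervalIntegrable (fun t => ⟪P.q t, w t⟫_ℝ) volume 0 P.T :=
  intervalIntegrable_of_integrable (memLp_one_iff_integrable.1
    ((innerSL ℝ : L2 Ω →L[ℝ] L2 Ω →L[ℝ] ℝ).memLp_of_bilin 1 P.q_mem hw))

/-- The error representation by the continuous dual solution: the dual problem is tested with the
error `u - û`, the primal problem with `z`. -/
theorem Q_sub_Q_interp_eq {u z : ℝ → V} {uh : ℕ → V} (hu : P.IsPrimalSolution u)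
    (hz : P.IsDualSolution u (G.interp uh) z) :
    IntervalIntegrable (fun t => P.resPDE (G.interp uh) t (z t)) volume 0 P.T ∧
    P.Q (P.contRep u) - P.Q (fun t => P.emb (G.interp uh t))
      = ⟪P.u0 - P.emb (uh 0), P.contRep z 0⟫_ℝ
        + ∫ t in (0 : ℝ)..P.T, P.resPDE (G.interp uh) t (z t) := by
  obtain ⟨hu2, hu0, du, hdu2, hdu, hprimal⟩ := hu
  obtain ⟨hz2, hzT, dz, hdz2, hdz, hdual⟩ := hz
  have hT := P.T_pos
  have hcu := hu0.isContRep_contRep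
  have hcz := hzT.isContRep_contRep
  have hcu0 := hu0.contRep_eq (left_mem_Icc.2 hT.le)
  have hczT := hzT.contRep_eq (right_mem_Icc.2 hT.le)
  have hi2 : P.MemL2 (G.interp uh) := G.memLp_interp uh
  obtain ⟨hNu, hprim⟩ := hprimal z hz2
  obtain ⟨hML, hdu'⟩ := hdual (fun t => u t - G.interp uh t) (hu2.sub hi2)
  simp only [P.meanLin_Nl_sub_eq] at hML hdu'
  have ibp₁ := inner_sub_inner_eq_integral hT hu2 hz2 hdu2 hdz2 hcu.1 hcz.1 hcu.2 hcz.2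
    (hcu.isPrimitive hdu2 hdu) (hcz.isPrimitive hdz2 hdz)
  have ibp₂ := inner_sub_inner_eq_integral hT hi2 hz2 (memLp_dualEmb_slope uh) hdz2
    (P.emb.continuous.comp_continuousOn (G.continuousOn_interp uh)) hcz.1
    (Filter.Eventually.of_forall fun _ => rfl) hcz.2
    (isPrimitive_interp uh) (hcz.isPrimitive hdz2 hdz)
  have i_duz := intervalIntegrable_of_integrable (integrable_dual_apply hdu2 hz2)
  have i_dzu := intervalIntegrable_of_integrable (integrable_dual_apply hdz2 hu2)
  have i_dzi := intervalIntegrable_of_integrable (integrable_dual_apply hdz2 hi2)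
  have i_Diz := intervalIntegrable_of_integrable
    (integrable_dual_apply (memLp_dualEmb_slope (G := G) uh) hz2)
  have i_fz := intervalIntegrable_of_integrable (integrable_dual_apply P.f_mem hz2)
  have i_Buz := integrable_B hu2 hz2
  have i_Biz := integrable_B hi2 hz2
  -- Integrability of `𝓝(û; z)` comes from that of `𝓝(u; z)` and of the linearization.
  have i_Ni : IntervalIntegrable (fun t => P.Nl (G.interp uh t) (z t)) volume 0 P.T := by
    have := hNu.sub hML
    simpa using this
  have i_qu : IntervalIntegrable (fun t => ⟪P.q t, P.emb (u t)⟫_ℝ) volume 0 P.T :=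
    integrable_inner_q (P.emb.comp_memLp' hu2)
  have i_qi : IntervalIntegrable (fun t => ⟪P.q t, P.emb (G.interp uh t)⟫_ℝ) volume 0 P.T :=
    integrable_inner_q (P.emb.comp_memLp' hi2)
  have hres : (fun t => P.f t (z t) - P.dualEmb (G.slope uh t) (z t) - P.B (G.interp uh t) (z t)
        - P.Nl (G.interp uh t) (z t))
      =ᵐ[volume.restrict (Ioc 0 P.T)] fun t => P.resPDE (G.interp uh) t (z t) := by
    filter_upwards [G.deriv_interp_ae_eq uh] with t ht
    rw [resPDE, ht, dualEmb_apply]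
  have i_res := ((i_fz.sub i_Diz).sub i_Biz).sub i_Ni
  refine ⟨i_res.congr_ae (by rwa [uIoc_of_le hT.le]), ?_⟩
  have e_res : ∫ t in (0 : ℝ)..P.T, P.resPDE (G.interp uh) t (z t)
      = (∫ t in (0 : ℝ)..P.T, P.f t (z t))
        - (∫ t in (0 : ℝ)..P.T, P.dualEmb (G.slope uh t) (z t))
        - (∫ t in (0 : ℝ)..P.T, P.B (G.interp uh t) (z t))
        - ∫ t in (0 : ℝ)..P.T, P.Nl (G.interp uh t) (z t) := by
    rw [← intervalIntegral.integral_sub i_fz i_Diz,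
      ← intervalIntegral.integral_sub (i_fz.sub i_Diz) i_Biz,
      ← intervalIntegral.integral_sub ((i_fz.sub i_Diz).sub i_Biz) i_Ni,
      intervalIntegral.integral_of_le hT.le, intervalIntegral.integral_of_le hT.le]
    exact integral_congr_ae hres.symm
  have e_Q : ∫ t in (0 : ℝ)..P.T, ⟪P.q t, P.contRep u t⟫_ℝ
      = ∫ t in (0 : ℝ)..P.T, ⟪P.q t, P.emb (u t)⟫_ℝ := by
    rw [intervalIntegral.integral_of_le hT.le, intervalIntegral.integral_of_le hT.le]
    refine integral_congr_ae ?_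
    filter_upwards [hcu.2] with t ht
    rw [ht]
  simp only [map_sub, inner_sub_right] at hdu'
  rw [intervalIntegral.integral_add (i_duz.add i_Buz) hNu,
    intervalIntegral.integral_add i_duz i_Buz] at hprim
  have e_dual : ∫ t in (0 : ℝ)..P.T,
      (-(dz t (u t) - dz t (G.interp uh t)) + (P.B (z t) (u t) - P.B (z t) (G.interp uh t))
        + (P.Nl (u t) (z t) - P.Nl (G.interp uh t) (z t)))
      = -((∫ t in (0 : ℝ)..P.T, dz t (u t)) - ∫ t in (0 : ℝ)..P.T, dz t (G.interp uh t))
        + ((∫ t in (0 : ℝ)..P.T, P.B (u t) (z t))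
          - ∫ t in (0 : ℝ)..P.T, P.B (G.interp uh t) (z t))
        + ((∫ t in (0 : ℝ)..P.T, P.Nl (u t) (z t))
          - ∫ t in (0 : ℝ)..P.T, P.Nl (G.interp uh t) (z t)) := by
    simp only [fun t => P.B_symm (z t)]
    have i_neg : IntervalIntegrable (fun t => -(dz t (u t) - dz t (G.interp uh t)))
        volume 0 P.T := (i_dzu.sub i_dzi).neg
    rw [intervalIntegral.integral_add (i_neg.add (i_Buz.sub i_Biz))
        (hNu.sub i_Ni),
      intervalIntegral.integral_add i_neg (i_Buz.sub i_Biz),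
      intervalIntegral.integral_neg, intervalIntegral.integral_sub i_dzu i_dzi,
      intervalIntegral.integral_sub i_Buz i_Biz, intervalIntegral.integral_sub hNu i_Ni]
  rw [e_dual, intervalIntegral.integral_sub i_qu i_qi] at hdu'
  rw [intervalIntegral.integral_add i_duz i_dzu, hcu0, hczT] at ibp₁
  rw [intervalIntegral.integral_add i_Diz i_dzi, hczT,
    Function.comp_apply, Function.comp_apply, G.interp_zero uh hT] at ibp₂
  rw [Q, Q, e_Q, e_res, inner_sub_left, real_inner_comm, real_inner_comm _ P.qbar]
  linear_combination ibp₁ - ibp₂ - hdu' + hprim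

variable {fk : ℕ → StrongDual ℝ V} {uh : ℕ → V}

variable (P) in
/-- The residuals satisfy `r_PDE = r_h + r_τ + r_f` inside each time step. -/
lemma resPDE_sub_add_resTau {k : ℕ} (hk : k < G.N) {t : ℝ}
    (ht : t ∈ Ioo (G.node k) (G.node (k + 1))) (v w : V) :
    P.resPDE (G.interp uh) t (v - w) + P.resTau G uh k t w
      = P.resPDE (G.interp uh) t v - P.resF fk k t w - P.resH G fk uh k w := by
  have hd := (G.hasDerivAt_interp uh hk ht).deriv
  simp only [resPDE, resTau, resF, resH, hd, map_sub, inner_sub_right, sub_apply]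
  ring

/-- The integrability of `𝓝(û; w)` for a fixed `w` is not needed, since this term cancels between
`r_PDE` and `r_τ`. -/
lemma integral_resPDE_sub_add_resTau {z : ℝ → V}
    (hres : IntervalIntegrable (fun t => P.resPDE (G.interp uh) t (z t)) volume 0 P.T)
    {k : ℕ} (hk : k < G.N) (w : V) :
    (∫ t in (G.node k)..(G.node (k + 1)),
        (P.resPDE (G.interp uh) t (z t - w) + P.resTau G uh k t w))
      + ∫ t in (G.node k)..(G.node (k + 1)), P.resF fk k t w
      = (∫ t in (G.node k)..(G.node (k + 1)), P.resPDE (G.interp uh) t (z t))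
        - G.tau (k + 1) * P.resH G fk uh k w := by
  have hle := (G.node_lt k hk).le
  have hsub : uIcc (G.node k) (G.node (k + 1)) ⊆ uIcc 0 P.T := by
    rw [uIcc_of_le hle, uIcc_of_le P.T_pos.le]
    exact Icc_subset_Icc (G.node_nonneg hk.le) (G.node_le_T hk)
  have i1 := hres.mono_set hsub
  have i2 : IntervalIntegrable (fun t => P.resF fk k t w) volume (G.node k) (G.node (k + 1)) :=
    (intervalIntegrable_of_integrable (integrable_dual_apply
      (P.f_mem.sub (memLp_const (fk (k + 1)))) (memLp_const w))).mono_set hsub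
  have e : ∫ t in (G.node k)..(G.node (k + 1)),
        (P.resPDE (G.interp uh) t (z t - w) + P.resTau G uh k t w)
      = ∫ t in (G.node k)..(G.node (k + 1)), (P.resPDE (G.interp uh) t (z t)
        - P.resF fk k t w - P.resH G fk uh k w) := by
    rw [intervalIntegral.integral_of_le hle, intervalIntegral.integral_of_le hle,
      integral_Ioc_eq_integral_Ioo, integral_Ioc_eq_integral_Ioo]
    exact setIntegral_congr_fun measurableSet_Ioo fun t ht =>
      P.resPDE_sub_add_resTau hk ht (z t) w
  rw [e, intervalIntegral.integral_sub (i1.sub i2) (by simp), intervalIntegral.integral_sub i1 i2,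
    intervalIntegral.integral_const, smul_eq_mul, ← G.tau_succ]
  ring

/-- The temporal error representation is the one by the continuous dual solution, less the one by
the discrete dual solution. -/
lemma temporalRep_add_osc_eq {z : ℝ → V} {zk : ℕ → V}
    (hres : IntervalIntegrable (fun t => P.resPDE (G.interp uh) t (z t)) volume 0 P.T) :
    P.temporalRep G uh z zk + P.osc G fk zk
      = ⟪P.u0 - P.emb (uh 0), P.contRep z 0⟫_ℝ
        + (∫ t in (0 : ℝ)..P.T, P.resPDE (G.interp uh) t (z t))
        - P.spatialRep G fk uh zk := by
  rw [temporalRep, osc, spatialRep, add_assoc, ← Finset.sum_add_distrib,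
    Finset.sum_congr rfl fun k hk =>
      integral_resPDE_sub_add_resTau hres (Finset.mem_range.1 hk) (zk (k + 1)),
    Finset.sum_sub_distrib, G.sum_integral_eq P.T_pos hres, inner_sub_right]
  ring

end Problem

end IMEX

end

/-- Splitting of the error in the quantity of interest into its temporal and spatial parts. The
approximations `fk k` of the source on the `k`-th time step are arbitrary; this covers both the
point values `f(t_k)` and the time averages of `f`. -/
theorem mainTheorem3 {d : ℕ} {Ω : Set (EuclideanSpace ℝ (Fin d))}
    (hΩ_open : IsOpen Ω) (hΩ_bdd : Bornology.IsBounded Ω)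
    {V : Type*} [NormedAddCommGroup V] [InnerProductSpace ℝ V] [CompleteSpace V]
    (P : IMEX.Problem Ω V) (G : IMEX.TimeGrid P.T) (fk : ℕ → StrongDual ℝ V)
    (M : ℕ → IMEX.Mesh Ω) (p : ℕ)
    (u : ℝ → V) (hu : P.IsPrimalSolution u)
    (uτ₀ : IMEX.L2 Ω) (uτ : ℕ → V) (huτ : P.IsTimeDiscreteSolution G fk uτ₀ uτ)
    (uh : ℕ → V)
    (huh : P.IsFullyDiscreteSolution G fk (fun k => P.femSpace (M k) p) uh)
    (z : ℝ → V) (hz : P.IsDualSolution u (G.interp uh) z)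
    (zτ : ℕ → V) (hzτ : P.IsTimeDiscreteDualSolution G uτ₀ uτ uh zτ) :
    P.Q (P.contRep u) - P.Q (G.interp (P.levels uτ₀ uτ))
        = P.temporalRep G uh z zτ + P.osc G fk zτ ∧
    ∀ vh : ℕ → V, (∀ k ≤ G.N, vh k ∈ P.femSpace (M k) p) →
      P.Q (G.interp (P.levels uτ₀ uτ)) - P.Q (fun t => P.emb (G.interp uh t))
        = P.spatialRep G fk uh (fun k => zτ k - vh k) := by
  have hspatial := IMEX.Problem.Q_interp_sub_Q_interp_eq huτ hzτ
  obtain ⟨hres, htotal⟩ := IMEX.Problem.Q_sub_Q_interp_eq hu hz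
  refine ⟨?_, fun vh hvh => ?_⟩
  · rw [IMEX.Problem.temporalRep_add_osc_eq hres, ← htotal, ← hspatial]
    ring
  · rw [huh.spatialRep_sub hvh, hspatial]
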